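/- All varieties are complex quasi-projective (possibly reducible or empty) varieties, all groups are finite. For a finite group $G$, a $G$-variety $(Z,G)$ is a variety $Z$ with a left action of $G$ by automorphisms. A variety with a finite groups action is a variety $\mathcal X$ represented as a finite disjoint union of locally closed subvarieties $X_i$ with actions of finite groups $G_i$ on them; a partition of $\mathcal X$ consists of finite partitions of the components $X_i$ into $G_i$-invariant locally closed subvarieties. Two pairs $(Z,G)$, $(Z',G')$ are isomorphic if there are isomorphisms $\varphi:G\to G'$ and $\psi:Z\to Z'$ with $\psi(gx)=\varphi(g)\psi(x)$; $\mathcal X$ and $\mathcal Y$ are equivalent if they have finite partitions with pairwise isomorphic parts. If $G\subset H$, then ${\rm ind}_G^H Z=(H\times Z)/\!\sim$, where $(h,x)\sim(hg^{-1},gx)$ for $g\in G$, with $H$ acting by left multiplication. Let $K_0^{\rm fGr}({\rm Var}_{\mathbb C})$ be the Abelian group generated by the classes $[\mathcal X]$ of varieties with finite groups actions modulo the relations: (1) $[\mathcal X]=[\mathcal Y]$ if $\mathcal X$ and $\mathcal Y$ are equivalent; (2) $[\mathcal X]=[\mathcal Y]+[\mathcal X\setminus\mathcal Y]$ if $\mathcal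 Y\subset\mathcal X$ is Zariski closed and invariant; (3) $[({\rm ind}_G^H Z,H)]=[(Z,G)]$ for $G\subset H$; it is a commutative ring with the multiplication given by the Cartesian product (with the products of the groups acting). For a $G$-variety $Z$, let $\Delta_G\subset Z^n$ be the set of $n$-tuples with at least two entries in the same $G$-orbit, let $G_n=G^n\rtimes S_n$ be the wreath product acting on $Z^n$ and on $Z^n\setminus\Delta_G$, and let $$\lambda_{(Z,G)}(t)=1+\sum_{n\ge 1}[(Z^n\setminus\Delta_G,G_n)]\,t^n\in 1+t\,K_0^{\rm fGr}({\rm Var}_{\mathbb C})[[t]].$$ **Proposition.** (i) For $G$-varieties $Z_1$, $Z_2$ one has $\lambda_{(Z_1\sqcup Z_2,G)}(t)=\lambda_{(Z_1,G)}(t)\cdot\lambda_{(Z_2,G)}(t)$; the same holds if a $G$-variety $Z$ is the disjoint union of two $G$-invariant locally closed subvarieties $Z_1$ and $Z_2$, that is, $\lambda_{(Z,G)}(t)=\lambda_{(Z_1,G)}(t)\cdot\lambda_{(Z_2,G)}(t)$. (ii) If $Z$ is a $G$-variety and $G\subset H$, then $\lambda_{(Z,G)}(t)=\lambda_{({\rm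 ind}_G^H Z,H)}(t)$. (iii) Hence $\lambda$ defines a $\lambda$-structure: there is a unique map $a\mapsto\lambda_a(t)$ from $K_0^{\rm fGr}({\rm Var}_{\mathbb C})$ to $1+t\,K_0^{\rm fGr}({\rm Var}_{\mathbb C})[[t]]$ with $\lambda_{a+b}(t)=\lambda_a(t)\lambda_b(t)$ and $\lambda_a(t)=1+at+\ldots$ for all $a$, $b$, such that $\lambda_{[(Z,G)]}(t)=\lambda_{(Z,G)}(t)$ for all pairs $(Z,G)$. -/

import Mathlib

namespace FGr

open MvPolynomial
open scoped Topology

/-! ### Complex quasi-projective varieties -/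

/-- Complex projective space with homogeneous coordinates indexed by `ι`. -/
def ProjSpace (ι : Type) : Type := Projectivization ℂ (ι → ℂ)

/-- The point of projective space with homogeneous coordinates `v`. -/
noncomputable def ProjSpace.mk {ι : Type} (v : ι → ℂ) (hv : v ≠ 0) : ProjSpace ι := Projectivization.mk ℂ v hv

/-- A vector of homogeneous coordinates of a point. -/
noncomputable def ProjSpace.rep {ι : Type} (p : ProjSpace ι) : ι → ℂ := Projectivization.rep p

/-- The Zariski topology: it is generated by the standard open sets `F ≠ 0`, for homogeneous
polynomials `F`. -/
noncomputable instance ProjSpace.zariski (ι : Type) : TopologicalSpace (ProjSpace ι) :=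
  TopologicalSpace.generateFrom
    {U | ∃ (F : MvPolynomial ι ℂ) (d : ℕ), F.IsHomogeneous d ∧ U = {p | eval p.rep F ≠ 0}}

/-- A complex quasi-projective variety: a set together with an identification with a Zariski locally
closed subset of the projective space with homogeneous coordinates indexed by a finite set `ι`.
The point `x` has the homogeneous coordinates `coord x`. Varieties may be reducible or empty. -/
structure QPVar where
  carrier : Type
  ι : Type
  finite : Finite ι
  coord : carrier → ι → ℂ
  coord_ne : ∀ x, coord x ≠ 0
  inj : Function.Injective fun x => ProjSpace.mk (coord x) (coord_ne x)
  locallyClosed : IsLocallyClosed (Set.range fun x => ProjSpace.mk (coord x) (coord_ne x))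

namespace QPVar

/-- The embedding of a quasi-projective variety into projective space. -/
noncomputable def pt (X : QPVar) (x : X.carrier) : ProjSpace X.ι := ProjSpace.mk (X.coord x) (X.coord_ne x)

/-- The Zariski topology of a quasi-projective variety. -/
@[reducible] noncomputable def top (X : QPVar) : TopologicalSpace X.carrier :=
  TopologicalSpace.induced X.pt inferInstance

end QPVar

/-- Morphisms of quasi-projective varieties: maps that are given, Zariski locally, by homogeneous
polynomials of the same degree in the homogeneous coordinates (not all of them vanishing at any
point under consideration). -/
def IsMor (X Y : QPVar) (f : X.carrier → Y.carrier) : Prop :=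
  ∀ x, ∃ U : Set X.carrier, IsOpen[X.top] U ∧ x ∈ U ∧
    ∃ (d : ℕ) (F : Y.ι → MvPolynomial X.ι ℂ), (∀ j, (F j).IsHomogeneous d) ∧
      ∀ y ∈ U, ∃ c : ℂ, c ≠ 0 ∧ ∀ j, eval (X.coord y) (F j) = c * Y.coord (f y) j

/-! ### Basic facts on the Zariski topology and on morphisms -/

theorem eval_smul_of_hom {ι : Type} {F : MvPolynomial ι ℂ} {d : ℕ} (hF : F.IsHomogeneous d)
    (c : ℂ) (v : ι → ℂ) : eval (fun i => c * v i) F = c ^ d * eval v F := by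
  rw [eval_eq, eval_eq, Finset.mul_sum]
  refine Finset.sum_congr rfl fun m hm => ?_
  have h : m.degree = d := by
    have h := hF (mem_support_iff.1 hm)
    rwa [Finsupp.degree_eq_weight_one]
  simp only [mul_pow, Finset.prod_mul_distrib]
  rw [Finset.prod_pow_eq_pow_sum, ← h, Finsupp.degree_apply]
  ring

theorem mk_eq_iff {ι : Type} {v w : ι → ℂ} (hv : v ≠ 0) (hw : w ≠ 0) :
    ProjSpace.mk v hv = ProjSpace.mk w hw ↔ ∃ c : ℂ, c ≠ 0 ∧ ∀ i, v i = c * w i := by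
  refine (Projectivization.mk_eq_mk_iff' ℂ v w hv hw).trans ?_
  constructor
  · rintro ⟨a, rfl⟩
    refine ⟨a, ?_, fun i => rfl⟩
    rintro rfl
    simp at hv
  · rintro ⟨c, -, h⟩
    exact ⟨c, funext fun i => (h i).symm⟩

theorem rep_ne {ι : Type} (p : ProjSpace ι) : p.rep ≠ 0 := Projectivization.rep_nonzero p

theorem mk_rep {ι : Type} (p : ProjSpace ι) : ProjSpace.mk p.rep (rep_ne p) = p :=
  Projectivization.mk_rep p

theorem rep_mk {ι : Type} (v : ι → ℂ) (hv : v ≠ 0) :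
    ∃ c : ℂ, c ≠ 0 ∧ ∀ i, (ProjSpace.mk v hv).rep i = c * v i :=
  (mk_eq_iff (rep_ne _) hv).1 (mk_rep _)

theorem eval_rep_mk_ne {ι : Type} {F : MvPolynomial ι ℂ} {d : ℕ} (hF : F.IsHomogeneous d)
    (v : ι → ℂ) (hv : v ≠ 0) : eval (ProjSpace.mk v hv).rep F ≠ 0 ↔ eval v F ≠ 0 := by
  obtain ⟨c, hc, h⟩ := rep_mk v hv
  rw [show (ProjSpace.mk v hv).rep = fun i => c * v i from funext h, eval_smul_of_hom hF]
  simp [hc]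

theorem isOpen_ne {ι : Type} {F : MvPolynomial ι ℂ} {d : ℕ} (hF : F.IsHomogeneous d) :
    IsOpen {p : ProjSpace ι | eval p.rep F ≠ 0} :=
  TopologicalSpace.isOpen_generateFrom_of_mem ⟨F, d, hF, rfl⟩

theorem exists_basic {ι : Type} {U : Set (ProjSpace ι)} (hU : IsOpen U) {p : ProjSpace ι}
    (hp : p ∈ U) : ∃ (F : MvPolynomial ι ℂ) (d : ℕ), F.IsHomogeneous d ∧ eval p.rep F ≠ 0 ∧
      {q : ProjSpace ι | eval q.rep F ≠ 0} ⊆ U := by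
  induction hU with
  | basic s hs =>
    obtain ⟨F, d, hF, rfl⟩ := hs
    exact ⟨F, d, hF, hp, subset_rfl⟩
  | univ => exact ⟨1, 0, isHomogeneous_one _ _, by simp, Set.subset_univ _⟩
  | inter s t _ _ hs ht =>
    obtain ⟨F, d, hF, h1, h2⟩ := hs hp.1
    obtain ⟨G, e, hG, h3, h4⟩ := ht hp.2
    refine ⟨F * G, d + e, hF.mul hG, by simp [h1, h3], fun q hq => ?_⟩
    simp only [map_mul, ne_eq, mul_eq_zero, not_or, Set.mem_ofPred_eq] at hq
    exact ⟨h2 hq.1, h4 hq.2⟩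
  | sUnion S _ ih =>
    obtain ⟨s, hs, hps⟩ := hp
    obtain ⟨F, d, hF, h1, h2⟩ := ih s hs hps
    exact ⟨F, d, hF, h1, h2.trans (Set.subset_sUnion_of_mem hs)⟩

theorem eval_bind {σ τ : Type} (v : τ → ℂ) (F : σ → MvPolynomial τ ℂ) (G : MvPolynomial σ ℂ) :
    eval v (bind₁ F G) = eval (fun i => eval v (F i)) G := by
  induction G using MvPolynomial.induction_on with
  | C a => simp
  | add p q hp hq => simp [hp, hq]
  | mul_X p i hp => simp [hp]

/-- A map on a space with values in projective space is continuous if it is locally given by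
homogeneous polynomials. -/
theorem continuous_of_local {T : Type} [TopologicalSpace T] {κ ι : Type} (q : T → ProjSpace κ)
    (hq : Continuous q) (f : T → ProjSpace ι)
    (h : ∀ x, ∃ U : Set T, IsOpen U ∧ x ∈ U ∧ ∃ (d : ℕ) (F : ι → MvPolynomial κ ℂ),
      (∀ j, (F j).IsHomogeneous d) ∧
      ∀ y ∈ U, ∃ c : ℂ, c ≠ 0 ∧ ∀ j, eval (q y).rep (F j) = c * (f y).rep j) :
    Continuous f := by
  refine continuous_generateFrom_iff.2 ?_
  rintro _ ⟨G, e, hG, rfl⟩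
  rw [isOpen_iff_forall_mem_open]
  intro x hx
  obtain ⟨U, hU, hxU, d, F, hF, hc⟩ := h x
  have key : ∀ y ∈ U, (eval (q y).rep (bind₁ F G) ≠ 0 ↔ eval (f y).rep G ≠ 0) := by
    intro y hy
    obtain ⟨c, hc0, hc1⟩ := hc y hy
    rw [eval_bind, show (fun i => eval (q y).rep (F i)) = fun i => c * (f y).rep i from
      funext hc1, eval_smul_of_hom hG]
    simp [hc0]
  refine ⟨U ∩ q ⁻¹' {p | eval p.rep (bind₁ F G) ≠ 0}, fun y hy => ?_, hU.inter
    ((isOpen_ne (hG.aeval F hF)).preimage hq), hxU, (key x hxU).2 hx⟩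
  exact (key y hy.1).1 hy.2

namespace QPVar

theorem continuous_pt (X : QPVar) : Continuous[X.top, inferInstance] X.pt :=
  continuous_induced_dom

theorem isOpen_ne (X : QPVar) {F : MvPolynomial X.ι ℂ} {d : ℕ} (hF : F.IsHomogeneous d) :
    IsOpen[X.top] {x | eval (X.coord x) F ≠ 0} := by
  refine isOpen_induced_iff.2 ⟨_, FGr.isOpen_ne hF, ?_⟩
  ext x
  exact eval_rep_mk_ne hF _ _

theorem exists_basic (X : QPVar) {U : Set X.carrier} (hU : IsOpen[X.top] U) {x : X.carrier}
    (hx : x ∈ U) : ∃ (F : MvPolynomial X.ι ℂ) (d : ℕ), F.IsHomogeneous d ∧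
      eval (X.coord x) F ≠ 0 ∧ ∀ y, eval (X.coord y) F ≠ 0 → y ∈ U := by
  obtain ⟨V, hV, rfl⟩ := isOpen_induced_iff.1 hU
  obtain ⟨F, d, hF, h1, h2⟩ := FGr.exists_basic hV hx
  exact ⟨F, d, hF, (eval_rep_mk_ne hF _ _).1 h1, fun y hy => h2 ((eval_rep_mk_ne hF _ _).2 hy)⟩

theorem ext_pt (X : QPVar) {x y : X.carrier} {c : ℂ} (hc : c ≠ 0)
    (h : ∀ i, X.coord x i = c * X.coord y i) : x = y :=
  X.inj ((mk_eq_iff _ _).2 ⟨c, hc, h⟩)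

theorem coord_exists (X : QPVar) (x : X.carrier) : ∃ i, X.coord x i ≠ 0 :=
  Function.ne_iff.1 (X.coord_ne x)

theorem isInducing_pt (X : QPVar) : @Topology.IsInducing _ _ X.top _ X.pt :=
  @Topology.IsInducing.mk _ _ X.top _ _ rfl

end QPVar

theorem IsMor.continuous {X Y : QPVar} {f : X.carrier → Y.carrier} (hf : IsMor X Y f) :
    Continuous[X.top, Y.top] f := by
  let := X.top
  refine continuous_induced_rng.2 (continuous_of_local X.pt X.continuous_pt _ fun x => ?_)
  obtain ⟨U, hU, hx, d, F, hF, h⟩ := hf x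
  refine ⟨U, hU, hx, d, F, hF, fun y hy => ?_⟩
  obtain ⟨c, hc, h⟩ := h y hy
  obtain ⟨a, ha, h1⟩ := rep_mk (X.coord y) (X.coord_ne y)
  obtain ⟨b, hb, h2⟩ := rep_mk (Y.coord (f y)) (Y.coord_ne _)
  refine ⟨a ^ d * c * b⁻¹, by simp [ha, hc, hb], fun j => ?_⟩
  change eval (ProjSpace.mk (X.coord y) _).rep _ = _ * (ProjSpace.mk (Y.coord (f y)) _).rep j
  rw [show (ProjSpace.mk (X.coord y) (X.coord_ne y)).rep = fun i => a * X.coord y i from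
    funext h1, eval_smul_of_hom (hF j), h, h2]
  field_simp

theorem IsMor.id (X : QPVar) : IsMor X X id := fun x =>
  ⟨Set.univ, @isOpen_univ _ X.top, trivial, 1, MvPolynomial.X, isHomogeneous_X ℂ, fun y _ =>
    ⟨1, one_ne_zero, by simp⟩⟩

theorem IsMor.comp {X Y Z : QPVar} {g : Y.carrier → Z.carrier} {f : X.carrier → Y.carrier}
    (hg : IsMor Y Z g) (hf : IsMor X Y f) : IsMor X Z (g ∘ f) := fun x => by
  obtain ⟨U, hU, hx, d, F, hF, h1⟩ := hf x
  obtain ⟨V, hV, hy, e, G, hG, h2⟩ := hg (f x)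
  let := X.top
  let := Y.top
  refine ⟨U ∩ f ⁻¹' V, hU.inter (hV.preimage hf.continuous), ⟨hx, hy⟩, d * e,
    fun j => bind₁ F (G j), fun j => (hG j).aeval F hF, fun y hy => ?_⟩
  obtain ⟨a, ha, ha'⟩ := h1 y hy.1
  obtain ⟨b, hb, hb'⟩ := h2 (f y) hy.2
  refine ⟨a ^ e * b, by simp [ha, hb], fun j => ?_⟩
  rw [eval_bind, show (fun i => eval (X.coord y) (F i)) = fun i => a * Y.coord (f y) i from
      funext ha', eval_smul_of_hom (hG j), hb', mul_assoc]
  rfl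

theorem IsMor.congr {X Y : QPVar} {f g : X.carrier → Y.carrier} (h : IsMor X Y f)
    (hfg : ∀ x, f x = g x) : IsMor X Y g := (funext hfg : f = g) ▸ h

/-- Being a morphism is a local property. -/
theorem IsMor.congr_local {X Y : QPVar} {f : X.carrier → Y.carrier}
    (h : ∀ x, ∃ U : Set X.carrier, IsOpen[X.top] U ∧ x ∈ U ∧ ∃ g : X.carrier → Y.carrier,
      IsMor X Y g ∧ ∀ y ∈ U, f y = g y) : IsMor X Y f := fun x => by
  obtain ⟨U, hU, hx, g, hg, h⟩ := h x
  obtain ⟨V, hV, hxV, d, F, hF, h1⟩ := hg x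
  let := X.top
  refine ⟨U ∩ V, hU.inter hV, ⟨hx, hxV⟩, d, F, hF, fun y hy => ?_⟩
  rw [h y hy.1]
  exact h1 y hy.2

/-! ### Locally closed subsets of projective spaces -/

theorem lc_of_cover {T : Type} [TopologicalSpace T] {A : Set T}
    (h : ∀ x ∈ A, ∃ W : Set T, IsOpen W ∧ x ∈ W ∧ IsLocallyClosed (A ∩ W)) :
    IsLocallyClosed A := by
  refine ((isLocallyClosed_tfae A).out 0 3).2 fun x hx => ?_
  obtain ⟨W, hW, hxW, hl⟩ := h x hx
  obtain ⟨U, hxU, hU, hUA⟩ := ((isLocallyClosed_tfae (A ∩ W)).out 0 3 :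
    IsLocallyClosed (A ∩ W) ↔ ∀ x ∈ A ∩ W, ∃ U, x ∈ U ∧ IsOpen U ∧ U ∩ closure (A ∩ W) ⊆ A ∩ W).1
    hl x ⟨hx, hxW⟩
  refine ⟨U ∩ W, ⟨hxU, hxW⟩, hU.inter hW, fun y hy => ?_⟩
  exact (hUA ⟨hy.1.1, by rw [Set.inter_comm]; exact hW.inter_closure ⟨hy.1.2, hy.2⟩⟩).1

theorem lc_iInter {T I : Type} [TopologicalSpace T] [Finite I] {A : I → Set T}
    (h : ∀ i, IsLocallyClosed (A i)) : IsLocallyClosed (⋂ i, A i) := by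
  choose U Z hU hZ h using h
  refine ⟨⋂ i, U i, ⋂ i, Z i, isOpen_iInter_of_finite hU, isClosed_iInter hZ, ?_⟩
  rw [← Set.iInter_inter_distrib]
  exact Set.iInter_congr h

theorem isClosed_eval_eq {ι : Type} {F : MvPolynomial ι ℂ} {d : ℕ} (hF : F.IsHomogeneous d) :
    IsClosed {p : ProjSpace ι | eval p.rep F = 0} :=
  ⟨isOpen_ne hF⟩

theorem lc_preimage {κ ι : Type} {d : ℕ} (F : ι → MvPolynomial κ ℂ)
    (hF : ∀ j, (F j).IsHomogeneous d) {B : Set (ProjSpace ι)} (hB : IsLocallyClosed B) :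
    IsLocallyClosed {p : ProjSpace κ |
      ∃ h : (fun j => eval p.rep (F j)) ≠ 0, ProjSpace.mk _ h ∈ B} := by
  let W : Set (ProjSpace κ) := {p | (fun j => eval p.rep (F j)) ≠ 0}
  have hW : IsOpen W := by
    have : W = ⋃ j, {p | eval p.rep (F j) ≠ 0} := by
      ext p
      simp [W, Function.ne_iff]
    rw [this]
    exact isOpen_iUnion fun j => isOpen_ne (hF j)
  let f : W → ProjSpace ι := fun p => ProjSpace.mk _ p.2
  have hf : Continuous f := by
    refine continuous_of_local Subtype.val continuous_subtype_val f fun x => ?_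
    refine ⟨Set.univ, isOpen_univ, trivial, d, F, hF, fun y _ => ?_⟩
    obtain ⟨c, hc, h⟩ := rep_mk _ y.2
    refine ⟨c⁻¹, inv_ne_zero hc, fun j => ?_⟩
    change _ = c⁻¹ * (ProjSpace.mk _ y.2).rep j
    rw [h]
    field_simp
  have h1 := (hB.preimage hf).image (Topology.IsInducing.subtypeVal (t := W)) (by
    rw [Subtype.range_val]
    exact hW.isLocallyClosed)
  convert h1 using 1
  ext p
  constructor
  · rintro ⟨h, hp⟩
    exact ⟨⟨p, h⟩, hp, rfl⟩
  · rintro ⟨⟨q, h⟩, hq, rfl⟩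
    exact ⟨h, hq⟩

/-! ### Subvarieties, products, disjoint unions -/

namespace QPVar

/-- Zariski locally closed subsets. -/
def IsLC (X : QPVar) (S : Set X.carrier) : Prop := @IsLocallyClosed _ X.top S

/-- A Zariski locally closed subset, as a quasi-projective variety. -/
@[reducible] noncomputable def sub (X : QPVar) (S : Set X.carrier) (hS : X.IsLC S) : QPVar where
  carrier := S
  ι := X.ι
  finite := X.finite
  coord x := X.coord x.1
  coord_ne x := X.coord_ne x.1
  inj x y h := Subtype.ext (X.inj h)
  locallyClosed := by
    let := X.top
    have h := IsLocallyClosed.image (s := S) hS X.isInducing_pt X.locallyClosed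
    rwa [Set.image_eq_range] at h

/-- Transport of the structure of a quasi-projective variety along a bijection. -/
@[reducible] noncomputable def transport (X : QPVar) {T : Type} (e : T ≃ X.carrier) : QPVar where
  carrier := T
  ι := X.ι
  finite := X.finite
  coord x := X.coord (e x)
  coord_ne x := X.coord_ne (e x)
  inj x y h := e.injective (X.inj h)
  locallyClosed := by
    have h := X.locallyClosed
    rwa [← e.surjective.range_comp] at h

/-- The one-point variety. -/
@[reducible] noncomputable def point : QPVar where
  carrier := Unit
  ι := Unit
  finite := inferInstance
  coord _ _ := 1
  coord_ne _ h := one_ne_zero (congrFun h ())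
  inj _ _ _ := rfl
  locallyClosed := by
    have : ∀ p : ProjSpace Unit, p = ProjSpace.mk (fun _ => (1 : ℂ))
        (fun h => one_ne_zero (congrFun h ())) := fun p => by
      obtain ⟨i, hi⟩ := Function.ne_iff.1 (rep_ne p)
      rw [← mk_rep p, mk_eq_iff]
      exact ⟨p.rep (), hi, fun i => by simp⟩
    rw [show (Set.range fun x : Unit => ProjSpace.mk (fun _ => (1 : ℂ))
        (fun h => one_ne_zero (congrFun h ()))) = Set.univ from
        Set.eq_univ_of_forall fun p => ⟨(), (this p).symm⟩]
    exact isOpen_univ.isLocallyClosed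

section pi

variable {I : Type} [Fintype I] (X : I → QPVar)

theorem segre_update [DecidableEq I] (x : ∀ i, (X i).carrier) (b : ∀ i, (X i).ι) (i : I)
    (k : (X i).ι) : ∏ j, (X j).coord (x j) (Function.update b i k j) =
      (∏ j ∈ Finset.univ.erase i, (X j).coord (x j) (b j)) * (X i).coord (x i) k := by
  rw [← Finset.prod_erase_mul _ _ (Finset.mem_univ i), Function.update_self]
  congr 1
  refine Finset.prod_congr rfl fun j hj => ?_
  rw [Function.update_of_ne (Finset.ne_of_mem_erase hj)]

theorem segre_ne (x : ∀ i, (X i).carrier) :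
    (fun a : ∀ i, (X i).ι => ∏ i, (X i).coord (x i) (a i)) ≠ 0 := by
  choose b hb using fun i => (X i).coord_exists (x i)
  exact Function.ne_iff.2 ⟨b, Finset.prod_ne_zero_iff.2 fun i _ => hb i⟩

/-- On the locus `a₀ ≠ 0`, the image of the Segre embedding is cut out by the Segre relations and
by the conditions that the components belong to the factors. -/
theorem segre_locus [DecidableEq I] (a₀ : ∀ i, (X i).ι) (p : ProjSpace (∀ i, (X i).ι))
    (h₀ : p.rep a₀ ≠ 0) :
    (p ∈ Set.range fun x : ∀ i, (X i).carrier => ProjSpace.mk _ (segre_ne X x)) ↔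
      (∀ (i : I) (a b : ∀ i, (X i).ι), p.rep a * p.rep b =
        p.rep (Function.update a i (b i)) * p.rep (Function.update b i (a i))) ∧
      ∀ i, ∃ h : (fun k => eval p.rep (MvPolynomial.X (Function.update a₀ i k))) ≠ 0,
        ProjSpace.mk _ h ∈ Set.range (X i).pt := by
  constructor
  · rintro ⟨x, rfl⟩
    obtain ⟨c, hc, h⟩ := rep_mk _ (segre_ne X x)
    refine ⟨fun i a b => ?_, fun i => ⟨?_, ?_⟩⟩
    · rw [h, h, h, h, segre_update, segre_update, ← Finset.prod_erase_mul _ _ (Finset.mem_univ i),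
        ← Finset.prod_erase_mul (a := i) _ (fun j => (X j).coord (x j) (b j)) (Finset.mem_univ i)]
      ring
    · refine Function.ne_iff.2 ⟨a₀ i, ?_⟩
      simpa using h₀
    · refine ⟨x i, ?_⟩
      rw [QPVar.pt, eq_comm, mk_eq_iff]
      rw [h] at h₀
      refine ⟨c * ∏ j ∈ Finset.univ.erase i, (X j).coord (x j) (a₀ j), ?_, fun k => ?_⟩
      · refine mul_ne_zero hc (Finset.prod_ne_zero_iff.2 fun j _ => ?_)
        exact Finset.prod_ne_zero_iff.1 (right_ne_zero_of_mul h₀) j (Finset.mem_univ j)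
      · rw [eval_X, h, segre_update]
        ring
  · rintro ⟨hS, hx⟩
    choose hne x hx using hx
    have hx' : ∀ i, ∃ c : ℂ, c ≠ 0 ∧ ∀ k, (X i).coord (x i) k =
        c * p.rep (Function.update a₀ i k) := fun i => by
      have := hx i
      rw [QPVar.pt, mk_eq_iff] at this
      simpa using this
    choose c hc hx' using hx'
    have key : ∀ (a : ∀ i, (X i).ι) (s : Finset I), p.rep a * p.rep a₀ ^ s.card =
        p.rep (s.piecewise a₀ a) * ∏ i ∈ s, p.rep (Function.update a₀ i (a i)) := by
      intro a s
      induction s using Finset.induction_on with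
      | empty => simp
      | insert i s hi ih =>
        rw [Finset.card_insert_of_notMem hi, pow_succ, ← mul_assoc, ih,
          Finset.prod_insert hi, Finset.piecewise_insert]
        have := hS i (s.piecewise a₀ a) a₀
        rw [Finset.piecewise_eq_of_notMem _ _ _ hi] at this
        calc _ = (p.rep (s.piecewise a₀ a) * p.rep a₀) *
              ∏ i ∈ s, p.rep (Function.update a₀ i (a i)) := by ring
          _ = _ := by rw [this]; ring
    refine ⟨x, ?_⟩
    conv_rhs => rw [← mk_rep p]
    rw [mk_eq_iff]
    have hpow : p.rep a₀ ^ (Finset.univ : Finset I).card ≠ 0 := pow_ne_zero _ h₀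
    refine ⟨(∏ i, c i) * p.rep a₀ ^ (Finset.univ : Finset I).card / p.rep a₀, ?_, fun a => ?_⟩
    · exact div_ne_zero (mul_ne_zero (Finset.prod_ne_zero_iff.2 fun i _ => hc i) hpow) h₀
    · have h1 := key a Finset.univ
      rw [Finset.piecewise_univ] at h1
      simp only [hx', Finset.prod_mul_distrib]
      field_simp
      linear_combination (-(∏ i, c i)) * h1

/-- The product of finitely many quasi-projective varieties, by the Segre embedding. -/
@[reducible] noncomputable def pi : QPVar where
  carrier := ∀ i, (X i).carrier
  ι := ∀ i, (X i).ι
  finite := by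
    have := fun i => (X i).finite
    infer_instance
  coord x a := ∏ i, (X i).coord (x i) (a i)
  coord_ne := segre_ne X
  inj x y h := by
    classical
    obtain ⟨c, hc, h⟩ := (mk_eq_iff _ _).1 h
    choose b hb using fun i => (X i).coord_exists (x i)
    funext i
    have h1 : ∀ k, _ := fun k => h (Function.update b i k)
    simp only [segre_update] at h1
    have hP : ∏ j ∈ Finset.univ.erase i, (X j).coord (x j) (b j) ≠ 0 :=
      Finset.prod_ne_zero_iff.2 fun j _ => hb j
    have hQ : ∏ j ∈ Finset.univ.erase i, (X j).coord (y j) (b j) ≠ 0 := fun h0 => by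
      have := h1 (b i)
      rw [h0] at this
      rw [zero_mul, mul_zero] at this
      exact mul_ne_zero hP (hb i) this
    refine (X i).ext_pt (c := c * (∏ j ∈ Finset.univ.erase i, (X j).coord (y j) (b j)) /
      ∏ j ∈ Finset.univ.erase i, (X j).coord (x j) (b j))
      (div_ne_zero (mul_ne_zero hc hQ) hP) fun k => ?_
    have := h1 k
    field_simp
    rw [mul_comm, this]
    ring
  locallyClosed := by
    classical
    have := fun i => (X i).finite
    refine lc_of_cover fun p hp => ?_
    obtain ⟨a₀, h₀⟩ := Function.ne_iff.1 (rep_ne p)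
    have hX : ∀ a : ∀ i, (X i).ι, (MvPolynomial.X (R := ℂ) a).IsHomogeneous 1 :=
      fun a => isHomogeneous_X ℂ a
    have hW : IsOpen {q : ProjSpace (∀ i, (X i).ι) | q.rep a₀ ≠ 0} := by
      simpa using FGr.isOpen_ne (hX a₀)
    refine ⟨_, hW, h₀, ?_⟩
    have hS : IsClosed {q : ProjSpace (∀ i, (X i).ι) | ∀ (i : I) (a b : ∀ i, (X i).ι),
        q.rep a * q.rep b =
        q.rep (Function.update a i (b i)) * q.rep (Function.update b i (a i))} := by
      have : {q : ProjSpace (∀ i, (X i).ι) | ∀ (i : I) (a b : ∀ i, (X i).ι),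
        q.rep a * q.rep b =
        q.rep (Function.update a i (b i)) * q.rep (Function.update b i (a i))} =
        ⋂ (i : I) (a : ∀ i, (X i).ι) (b : ∀ i, (X i).ι), {q | eval q.rep
          (MvPolynomial.X a * MvPolynomial.X b - MvPolynomial.X (Function.update a i (b i)) *
            MvPolynomial.X (Function.update b i (a i))) = 0} := by
        ext q
        simp [sub_eq_zero]
      rw [this]
      exact isClosed_iInter fun i => isClosed_iInter fun a => isClosed_iInter fun b =>
        isClosed_eval_eq (((hX _).mul (hX _)).sub ((hX _).mul (hX _)))
    have h := (hS.isLocallyClosed.inter (lc_iInter fun i => lc_preimage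
      (fun k => MvPolynomial.X (Function.update a₀ i k)) (fun k => hX _)
      (X i).locallyClosed)).inter hW.isLocallyClosed
    convert h using 1
    ext q
    refine and_congr_left fun hq => ?_
    rw [Set.mem_inter_iff, Set.mem_iInter]
    exact segre_locus X a₀ q hq

end pi

end QPVar

theorem isMor_apply {I : Type} [Fintype I] (X : I → QPVar) (i : I) :
    IsMor (QPVar.pi X) (X i) (fun x => x i) := fun x => by
  classical
  choose b hb using fun i => (X i).coord_exists (x i)
  refine ⟨_, (QPVar.pi X).isOpen_ne (isHomogeneous_X ℂ b), ?_, 1,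
    fun k => MvPolynomial.X (Function.update b i k), fun k => isHomogeneous_X ℂ _, fun y hy => ?_⟩
  · rw [Set.mem_ofPred_eq, eval_X]
    exact Finset.prod_ne_zero_iff.2 fun i _ => hb i
  · rw [Set.mem_ofPred_eq, eval_X] at hy
    have hy := Finset.prod_ne_zero_iff.1 hy
    refine ⟨∏ j ∈ Finset.univ.erase i, (X j).coord (y j) (b j),
      Finset.prod_ne_zero_iff.2 fun j _ => hy j (Finset.mem_univ j), fun k => ?_⟩
    rw [eval_X]
    exact QPVar.segre_update X y b i k

theorem isMor_pi {I : Type} [Fintype I] {W : QPVar} (X : I → QPVar)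
    {f : W.carrier → ∀ i, (X i).carrier} (hf : ∀ i, IsMor W (X i) (fun w => f w i)) :
    IsMor W (QPVar.pi X) f := fun w => by
  choose U hU hw d F hF h using fun i => hf i w
  let := W.top
  refine ⟨⋂ i, U i, isOpen_iInter_of_finite hU, Set.mem_iInter.2 hw, ∑ i, d i,
    fun a => ∏ i, F i (a i), fun a => IsHomogeneous.prod _ _ _ fun i _ => hF i _, fun y hy => ?_⟩
  choose c hc h using fun i => h i y (Set.mem_iInter.1 hy i)
  refine ⟨∏ i, c i, Finset.prod_ne_zero_iff.2 fun i _ => hc i, fun a => ?_⟩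
  rw [map_prod]
  simp only [h, Finset.prod_mul_distrib]

theorem isMor_val (X : QPVar) (S : Set X.carrier) (hS : X.IsLC S) :
    IsMor (X.sub S hS) X Subtype.val := fun x =>
  ⟨Set.univ, @isOpen_univ _ (X.sub S hS).top, trivial, 1, MvPolynomial.X, isHomogeneous_X ℂ,
    fun y _ => ⟨1, one_ne_zero, fun j => by rw [eval_X, one_mul]⟩⟩

theorem isMor_codRestrict {W X : QPVar} {S : Set X.carrier} (hS : X.IsLC S)
    {f : W.carrier → S} (hf : IsMor W X (fun w => (f w).1)) : IsMor W (X.sub S hS) f := hf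

theorem isMor_transport (X : QPVar) {T : Type} (e : T ≃ X.carrier) :
    IsMor (X.transport e) X e := fun x =>
  ⟨Set.univ, @isOpen_univ _ (X.transport e).top, trivial, 1, MvPolynomial.X, isHomogeneous_X ℂ,
    fun y _ => ⟨1, one_ne_zero, fun j => by rw [eval_X, one_mul]⟩⟩

theorem isMor_to_transport (X : QPVar) {T : Type} (e : T ≃ X.carrier) {W : QPVar}
    {f : W.carrier → T} (hf : IsMor W X (fun w => e (f w))) : IsMor W (X.transport e) f := hf

namespace QPVar

/-- The product of two quasi-projective varieties, by the Segre embedding. -/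
@[reducible] noncomputable def prod (X Y : QPVar) : QPVar :=
  (pi (fun b : Bool => match b with | false => X | true => Y)).transport
    (T := X.carrier × Y.carrier)
    { toFun := fun p b => match b with | false => p.1 | true => p.2
      invFun := fun f => (f false, f true)
      left_inv := fun _ => rfl
      right_inv := fun f => by funext b; cases b <;> rfl }

end QPVar

theorem isMor_fst (X Y : QPVar) : IsMor (X.prod Y) X Prod.fst :=
  (isMor_apply (fun b : Bool => match b with | false => X | true => Y) false).comp
    (isMor_transport _ _)

theorem isMor_snd (X Y : QPVar) : IsMor (X.prod Y) Y Prod.snd :=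
  (isMor_apply (fun b : Bool => match b with | false => X | true => Y) true).comp
    (isMor_transport _ _)

theorem isMor_prodMk {W X Y : QPVar} {f : W.carrier → X.carrier} {g : W.carrier → Y.carrier}
    (hf : IsMor W X f) (hg : IsMor W Y g) : IsMor W (X.prod Y) (fun w => (f w, g w)) :=
  isMor_to_transport _ _ (isMor_pi _ fun b => match b with | false => hf | true => hg)

theorem isMor_prodMap {X Y X' Y' : QPVar} {f : X.carrier → X'.carrier}
    {g : Y.carrier → Y'.carrier} (hf : IsMor X X' f) (hg : IsMor Y Y' g) :
    IsMor (X.prod Y) (X'.prod Y') (Prod.map f g) :=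
  isMor_prodMk (hf.comp (isMor_fst X Y)) (hg.comp (isMor_snd X Y))

namespace QPVar

section sigma

variable {I : Type} (X : I → QPVar)

open Classical in
/-- The homogeneous coordinates of a point of a disjoint union: those of the point of the summand
it belongs to, and zeros in the coordinates of the other summands. -/
noncomputable def sigmaCoord (x : Σ i, (X i).carrier) (a : Σ i, (X i).ι) : ℂ :=
  (Pi.single x.1 ((X x.1).coord x.2) : ∀ j, (X j).ι → ℂ) a.1 a.2

theorem sigmaCoord_self (i : I) (x : (X i).carrier) (a : (X i).ι) :
    sigmaCoord X ⟨i, x⟩ ⟨i, a⟩ = (X i).coord x a := by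
  simp [sigmaCoord]

theorem sigmaCoord_of_ne (i : I) (x : (X i).carrier) (j : I) (h : j ≠ i) (a : (X j).ι) :
    sigmaCoord X ⟨i, x⟩ ⟨j, a⟩ = 0 := by
  classical
  simp [sigmaCoord, Pi.single_eq_of_ne h]

theorem sigmaCoord_ne (x : Σ i, (X i).carrier) : sigmaCoord X x ≠ 0 := by
  obtain ⟨i, x⟩ := x
  obtain ⟨a, ha⟩ := (X i).coord_exists x
  exact Function.ne_iff.2 ⟨⟨i, a⟩, by rwa [sigmaCoord_self]⟩

/-- The disjoint union of finitely many quasi-projective varieties. -/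
@[reducible] noncomputable def sigma [Finite I] : QPVar where
  carrier := Σ i, (X i).carrier
  ι := Σ i, (X i).ι
  finite := by
    have := fun i => (X i).finite
    infer_instance
  coord := sigmaCoord X
  coord_ne := sigmaCoord_ne X
  inj := by
    rintro ⟨i, x⟩ ⟨j, y⟩ h
    obtain ⟨c, hc, h⟩ := (mk_eq_iff _ _).1 h
    obtain ⟨a, ha⟩ := (X i).coord_exists x
    by_cases hij : i = j
    · subst hij
      have hxy : x = y :=
        (X i).ext_pt hc fun k => by simpa only [sigmaCoord_self] using h ⟨i, k⟩
      rw [hxy]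
    · have := h ⟨i, a⟩
      rw [sigmaCoord_self, sigmaCoord_of_ne X j y i hij, mul_zero] at this
      exact absurd this ha
  locallyClosed := by
    classical
    have hX : ∀ a : Σ i, (X i).ι, (MvPolynomial.X (R := ℂ) a).IsHomogeneous 1 :=
      fun a => isHomogeneous_X ℂ a
    refine lc_of_cover ?_
    rintro _ ⟨⟨i, x⟩, rfl⟩
    refine ⟨⋃ a, {p : ProjSpace (Σ i, (X i).ι) | eval p.rep (MvPolynomial.X (⟨i, a⟩ : Σ i, (X i).ι)) ≠ 0},
      isOpen_iUnion fun a => FGr.isOpen_ne (hX _), ?_, ?_⟩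
    · obtain ⟨a, ha⟩ := (X i).coord_exists x
      refine Set.mem_iUnion.2 ⟨a, (eval_rep_mk_ne (hX _) _ _).2 ?_⟩
      rwa [eval_X, sigmaCoord_self]
    · have hL : IsClosed (⋂ (j : I) (_ : j ≠ i) (a : (X j).ι),
          {p : ProjSpace (Σ i, (X i).ι) | eval p.rep (MvPolynomial.X (⟨j, a⟩ : Σ i, (X i).ι)) = 0}) :=
        isClosed_iInter fun j => isClosed_iInter fun _ => isClosed_iInter fun a =>
          isClosed_eval_eq (hX _)
      have h := hL.isLocallyClosed.inter (lc_preimage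
        (fun a => MvPolynomial.X (⟨i, a⟩ : Σ i, (X i).ι)) (fun _ => hX _) (X i).locallyClosed)
      convert h using 1
      ext p
      simp only [Set.mem_inter_iff, Set.mem_iInter, Set.mem_iUnion, Set.mem_ofPred_eq, eval_X]
      constructor
      · rintro ⟨⟨⟨j, y⟩, rfl⟩, a, ha⟩
        obtain ⟨c, hc, hr⟩ := rep_mk _ (sigmaCoord_ne X ⟨j, y⟩)
        have hij : i = j := by
          by_contra hij
          rw [hr, sigmaCoord_of_ne X j y i hij] at ha
          simp at ha
        subst hij
        refine ⟨fun k hk b => by rw [hr, sigmaCoord_of_ne X i y k hk, mul_zero],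
          Function.ne_iff.2 ⟨a, ha⟩, y, ?_⟩
        beta_reduce
        rw [eq_comm, mk_eq_iff]
        exact ⟨c, hc, fun k => by rw [hr, sigmaCoord_self]⟩
      · rintro ⟨h1, h2, y, hy⟩
        obtain ⟨c, hc, hy⟩ := (mk_eq_iff _ _).1 hy
        refine ⟨⟨⟨i, y⟩, ?_⟩, Function.ne_iff.1 h2⟩
        conv_rhs => rw [← mk_rep p]
        beta_reduce
        rw [mk_eq_iff]
        refine ⟨c, hc, ?_⟩
        rintro ⟨j, a⟩
        by_cases hj : j = i
        · subst hj
          rw [sigmaCoord_self, hy]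
        · rw [sigmaCoord_of_ne X i y j hj, h1 j hj, mul_zero]

end sigma

/-- The disjoint union of two quasi-projective varieties. -/
@[reducible] noncomputable def sum (X Y : QPVar) : QPVar :=
  (sigma (fun b : Bool => match b with | false => X | true => Y)).transport
    (T := X.carrier ⊕ Y.carrier)
    { toFun := Sum.elim (fun x => ⟨false, x⟩) (fun y => ⟨true, y⟩)
      invFun := fun z => match z with | ⟨false, x⟩ => Sum.inl x | ⟨true, y⟩ => Sum.inr y
      left_inv := by rintro (x | y) <;> rfl
      right_inv := by rintro ⟨_ | _, x⟩ <;> rfl }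

end QPVar

theorem isMor_sigmaMk {I : Type} [Finite I] (X : I → QPVar) (i : I) :
    IsMor (X i) (QPVar.sigma X) (fun x => ⟨i, x⟩) := fun x => by
  classical
  refine ⟨Set.univ, @isOpen_univ _ (X i).top, trivial, 1,
    fun b => if h : b.1 = i then MvPolynomial.X (h ▸ b.2) else 0, ?_, fun y _ =>
      ⟨1, one_ne_zero, ?_⟩⟩
  · rintro ⟨j, b⟩
    by_cases h : j = i
    · subst h
      simp [isHomogeneous_X]
    · simp [h, isHomogeneous_zero]
  · rintro ⟨j, b⟩
    rw [one_mul]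
    change _ = QPVar.sigmaCoord X ⟨i, y⟩ ⟨j, b⟩
    by_cases h : j = i
    · subst h
      rw [QPVar.sigmaCoord_self]
      simp
    · rw [QPVar.sigmaCoord_of_ne X i y j h]
      simp [h]

theorem isMor_sigma {I : Type} [Finite I] (X : I → QPVar) {Y : QPVar}
    {f : (Σ i, (X i).carrier) → Y.carrier} (hf : ∀ i, IsMor (X i) Y (fun x => f ⟨i, x⟩)) :
    IsMor (QPVar.sigma X) Y f := by
  rintro ⟨i, x⟩
  obtain ⟨U, hU, hx, d, F, hF, h⟩ := hf i x
  obtain ⟨Q, e, hQ, hQx, hQU⟩ := (X i).exists_basic hU hx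
  obtain ⟨a, ha⟩ := (X i).coord_exists x
  have hev : ∀ (y : (X i).carrier) (G : MvPolynomial (X i).ι ℂ),
      eval ((QPVar.sigma X).coord ⟨i, y⟩) (rename (Sigma.mk i) G) = eval ((X i).coord y) G := by
    intro y G
    rw [eval_rename]
    congr 2
    funext a
    exact QPVar.sigmaCoord_self X i y a
  refine ⟨_, (QPVar.sigma X).isOpen_ne (F := rename (Sigma.mk i) (Q * MvPolynomial.X a))
    (hQ.mul (isHomogeneous_X ℂ a)).rename_isHomogeneous, ?_, d,
    fun k => rename (Sigma.mk i) (F k), fun k => (hF k).rename_isHomogeneous, ?_⟩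
  · rw [Set.mem_ofPred_eq, hev]
    simp [hQx, ha]
  · rintro ⟨j, y⟩ hy
    by_cases hj : i = j
    · subst hj
      rw [Set.mem_ofPred_eq, hev, map_mul] at hy
      simp only [hev]
      exact h y (hQU y (left_ne_zero_of_mul hy))
    · refine absurd ?_ hy
      rw [map_mul, map_mul, rename_X, eval_X]
      exact mul_eq_zero_of_right _ (QPVar.sigmaCoord_of_ne X j y i hj a)

theorem isMor_inl (X Y : QPVar) : IsMor X (X.sum Y) Sum.inl :=
  isMor_to_transport _ _
    (isMor_sigmaMk (fun b : Bool => match b with | false => X | true => Y) false)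

theorem isMor_inr (X Y : QPVar) : IsMor Y (X.sum Y) Sum.inr :=
  isMor_to_transport _ _
    (isMor_sigmaMk (fun b : Bool => match b with | false => X | true => Y) true)

theorem isMor_sum {X Y W : QPVar} {f : X.carrier ⊕ Y.carrier → W.carrier}
    (hl : IsMor X W (fun x => f (Sum.inl x))) (hr : IsMor Y W (fun y => f (Sum.inr y))) :
    IsMor (X.sum Y) W f := by
  have h : IsMor (QPVar.sigma (fun b : Bool => match b with | false => X | true => Y)) W
      (fun z => f (match z with | ⟨false, x⟩ => Sum.inl x | ⟨true, y⟩ => Sum.inr y)) :=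
    isMor_sigma _ fun b => match b with | false => hl | true => hr
  have h2 := h.comp (isMor_transport (QPVar.sigma (fun b : Bool => match b with
    | false => X | true => Y)) (T := X.carrier ⊕ Y.carrier)
    { toFun := Sum.elim (fun x => ⟨false, x⟩) (fun y => ⟨true, y⟩)
      invFun := fun z => match z with | ⟨false, x⟩ => Sum.inl x | ⟨true, y⟩ => Sum.inr y
      left_inv := by rintro (x | y) <;> rfl
      right_inv := by rintro ⟨_ | _, x⟩ <;> rfl })
  convert h2 using 1
  funext z
  rcases z with z | z <;> rfl

theorem IsMor.lc_preimage {X Y : QPVar} {f : X.carrier → Y.carrier} (hf : IsMor X Y f)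
    {S : Set Y.carrier} (hS : Y.IsLC S) : X.IsLC (f ⁻¹' S) := by
  let := X.top
  let := Y.top
  exact IsLocallyClosed.preimage (s := S) hS hf.continuous

theorem QPVar.IsLC.inter {X : QPVar} {S T : Set X.carrier} (hS : X.IsLC S) (hT : X.IsLC T) :
    X.IsLC (S ∩ T) := by
  let := X.top
  exact IsLocallyClosed.inter (s := S) (t := T) hS hT

theorem QPVar.isLC_of_isClosed {X : QPVar} {S : Set X.carrier} (hS : IsClosed[X.top] S) :
    X.IsLC S := by
  let := X.top
  exact IsClosed.isLocallyClosed hS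

theorem QPVar.isLC_of_isOpen {X : QPVar} {S : Set X.carrier} (hS : IsOpen[X.top] S) :
    X.IsLC S := by
  let := X.top
  exact IsOpen.isLocallyClosed hS

theorem QPVar.isLC_compl {X : QPVar} {S : Set X.carrier} (hS : IsClosed[X.top] S) :
    X.IsLC Sᶜ :=
  QPVar.isLC_of_isOpen ((@isOpen_compl_iff _ _ X.top).2 hS)

theorem QPVar.isLC_univ (X : QPVar) : X.IsLC Set.univ :=
  QPVar.isLC_of_isOpen (@isOpen_univ _ X.top)

/-- The locus where two morphisms coincide is closed. -/
theorem isClosed_eq_locus {X Y : QPVar} {f g : X.carrier → Y.carrier} (hf : IsMor X Y f)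
    (hg : IsMor X Y g) : IsClosed[X.top] {x | f x = g x} := by
  let := X.top
  rw [← isOpen_compl_iff, isOpen_iff_forall_mem_open]
  intro x hx
  obtain ⟨U, hU, hxU, d, F, hF, h1⟩ := hf x
  obtain ⟨V, hV, hxV, e, G, hG, h2⟩ := hg x
  have hd : ∀ i j, (F i * G j - F j * G i).IsHomogeneous (d + e) := fun i j =>
    ((hF i).mul (hG j)).sub ((hF j).mul (hG i))
  have key : ∀ y ∈ U ∩ V, f y = g y ↔ ∀ i j, eval (X.coord y) (F i * G j - F j * G i) = 0 := by
    rintro y ⟨hyU, hyV⟩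
    obtain ⟨a, ha, h1⟩ := h1 y hyU
    obtain ⟨b, hb, h2⟩ := h2 y hyV
    simp only [map_sub, map_mul, h1, h2]
    constructor
    · intro h i j
      rw [h]
      ring
    · intro h
      obtain ⟨j, hj⟩ := Y.coord_exists (g y)
      have hfj : Y.coord (f y) j ≠ 0 := fun h0 => by
        refine Y.coord_ne (f y) (funext fun i => ?_)
        have := h i j
        rw [h0] at this
        have h3 : a * Y.coord (f y) i * (b * Y.coord (g y) j) = 0 := by linear_combination this
        simpa [ha, hb, hj] using h3
      refine Y.ext_pt (c := Y.coord (f y) j / Y.coord (g y) j) (div_ne_zero hfj hj) fun i => ?_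
      have h3 : a * b * (Y.coord (f y) i * Y.coord (g y) j) =
          a * b * (Y.coord (f y) j * Y.coord (g y) i) := by linear_combination h i j
      have h4 := mul_left_cancel₀ (mul_ne_zero ha hb) h3
      field_simp
      exact h4
  have hx' : ¬ ∀ i j, eval (X.coord x) (F i * G j - F j * G i) = 0 := fun h =>
    hx ((key x ⟨hxU, hxV⟩).2 h)
  push Not at hx'
  obtain ⟨i, j, hij⟩ := hx'
  exact ⟨(U ∩ V) ∩ {y | eval (X.coord y) (F i * G j - F j * G i) ≠ 0},
    fun y hy h => hy.2 ((key y hy.1).1 h i j), (hU.inter hV).inter (X.isOpen_ne (hd i j)),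
    ⟨hxU, hxV⟩, hij⟩

/-! ### Varieties with an action of one finite group -/

/-- A `G`-variety: a quasi-projective variety with a (left) action of the group `G` by morphisms. -/
structure GVar (G : Type) [Group G] where
  X : QPVar
  act : G →* Equiv.Perm X.carrier
  mor : ∀ g, IsMor X X (act g)

/-- Two pairs `(Z, G)` and `(W, H)` are isomorphic if there are an isomorphism `φ : G → H` of groups
and an isomorphism `ψ : Z → W` of varieties with `ψ (g x) = φ(g) ψ (x)`. -/
def Isomorphic {G H : Type} [Group G] [Group H] (Z : GVar G) (W : GVar H) : Prop :=
  ∃ (φ : G ≃* H) (ψ : Z.X.carrier ≃ W.X.carrier), IsMor Z.X W.X ψ ∧ IsMor W.X Z.X ψ.symm ∧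
    ∀ g x, ψ (Z.act g x) = W.act (φ g) (ψ x)

namespace GVar

variable {G H : Type} [Group G] [Group H]

/-- Invariant subsets. -/
def Inv (Z : GVar G) (S : Set Z.X.carrier) : Prop := ∀ g, ∀ x ∈ S, Z.act g x ∈ S

theorem Inv.compl {Z : GVar G} {S : Set Z.X.carrier} (h : Z.Inv S) : Z.Inv Sᶜ := fun g _ hx hg =>
  hx (by simpa using h g⁻¹ _ hg)

theorem act_mul (Z : GVar G) (g h : G) (x : Z.X.carrier) :
    Z.act (g * h) x = Z.act g (Z.act h x) := by simp

theorem act_one (Z : GVar G) (x : Z.X.carrier) : Z.act 1 x = x := by simp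

/-- A `G`-variety from maps satisfying the axioms of an action. -/
@[reducible] noncomputable def ofMaps (X : QPVar) (a : G → X.carrier → X.carrier) (h1 : ∀ x, a 1 x = x)
    (hm : ∀ g h x, a (g * h) x = a g (a h x)) (hmor : ∀ g, IsMor X X (a g)) : GVar G where
  X := X
  act :=
    { toFun := fun g =>
        { toFun := a g
          invFun := a g⁻¹
          left_inv := fun x => by rw [← hm, inv_mul_cancel, h1]
          right_inv := fun x => by rw [← hm, mul_inv_cancel, h1] }
      map_one' := Equiv.ext h1
      map_mul' := fun g h => Equiv.ext (hm g h) }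
  mor := hmor

/-- An invariant locally closed subset, with the induced action. -/
@[reducible] noncomputable def sub (Z : GVar G) (S : Set Z.X.carrier) (hS : Z.X.IsLC S)
    (hi : Z.Inv S) : GVar G :=
  ofMaps (Z.X.sub S hS) (fun g x => ⟨Z.act g x.1, hi g x.1 x.2⟩)
    (fun x => Subtype.ext (Z.act_one x.1)) (fun g h x => Subtype.ext (Z.act_mul g h x.1))
    (fun g => isMor_codRestrict hS ((Z.mor g).comp (isMor_val _ S hS)))

/-- The Cartesian product, with the componentwise action of the product of the groups. -/
@[reducible] noncomputable def prod (Z : GVar G) (W : GVar H) : GVar (G × H) :=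
  ofMaps (Z.X.prod W.X) (fun g x => (Z.act g.1 x.1, W.act g.2 x.2))
    (fun x => Prod.ext (Z.act_one x.1) (W.act_one x.2))
    (fun _ _ _ => Prod.ext (Z.act_mul _ _ _) (W.act_mul _ _ _))
    (fun g => isMor_prodMap (Z.mor g.1) (W.mor g.2))

/-- The disjoint union of two `G`-varieties (for the same group `G`). -/
@[reducible] noncomputable def sum (Z W : GVar G) : GVar G :=
  ofMaps (Z.X.sum W.X) (fun g => Sum.map (Z.act g) (W.act g))
    (fun x => by rcases x with x | x <;> simp)
    (fun _ _ x => by rcases x with x | x <;> simp)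
    (fun g => isMor_sum ((isMor_inl Z.X W.X).comp (Z.mor g)) ((isMor_inr Z.X W.X).comp (W.mor g)))

/-- The one-point variety with the action of the trivial group. -/
@[reducible] noncomputable def point : GVar Unit :=
  ofMaps QPVar.point (fun _ x => x) (fun _ => rfl) (fun _ _ _ => rfl) (fun _ => IsMor.id _)

section ind

/-- The relation `(h₁, x₁) ∼ (h₂, x₂)` iff `h₂ = h₁ g⁻¹`, `x₂ = g x₁` for some `g` in `G`, where `G`
is regarded as a subgroup of `H` through the embedding `φ`. -/
def indRel (Z : GVar G) (φ : G →* H) : Setoid (H × Z.X.carrier) where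
  r p q := ∃ g : G, q.1 = p.1 * (φ g)⁻¹ ∧ q.2 = Z.act g p.2
  iseqv :=
    { refl := fun p => ⟨1, by simp⟩
      symm := by
        rintro p q ⟨g, h1, h2⟩
        exact ⟨g⁻¹, by simp [h1, h2]⟩
      trans := by
        rintro p q r ⟨g, h1, h2⟩ ⟨k, h3, h4⟩
        exact ⟨k * g, by simp [h1, h2, h3, h4, mul_assoc]⟩ }

/-- The underlying set of the induced variety. -/
def IndCarrier (Z : GVar G) (φ : G →* H) : Type := Quotient (Z.indRel φ)

/-- The class of `(h, x)`. -/
def indMk (Z : GVar G) (φ : G →* H) (h : H) (x : Z.X.carrier) : Z.IndCarrier φ :=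
  Quotient.mk (Z.indRel φ) (h, x)

theorem indMk_eq_iff (Z : GVar G) (φ : G →* H) (h k : H) (x y : Z.X.carrier) :
    Z.indMk φ h x = Z.indMk φ k y ↔ ∃ g : G, k = h * (φ g)⁻¹ ∧ y = Z.act g x :=
  Quotient.eq

/-- Choosing representatives of the left cosets of `G` identifies the induced variety with a
disjoint union of copies of `Z`. -/
noncomputable def indEquiv (Z : GVar G) (φ : G →* H) (hφ : Function.Injective φ) :
    Z.IndCarrier φ ≃ Σ _ : H ⧸ φ.range, Z.X.carrier :=
  (Equiv.ofBijective (fun p : Σ _ : H ⧸ φ.range, Z.X.carrier => Z.indMk φ p.1.out p.2) (by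
    constructor
    · rintro ⟨c, x⟩ ⟨d, y⟩ h
      obtain ⟨g, h1, h2⟩ := (Z.indMk_eq_iff φ _ _ _ _).1 h
      have hcd : c = d := by
        rw [← QuotientGroup.out_eq' c, ← QuotientGroup.out_eq' d, QuotientGroup.eq]
        change _ = c.out * _ at h1
        rw [show d.out = c.out * (φ g)⁻¹ from h1]
        simp
      subst hcd
      have hg : g = 1 := hφ (by simpa using h1)
      subst hg
      have h3 : y = x := by simpa using h2
      rw [h3]
    · intro q
      induction q using Quotient.inductionOn with
      | h p =>
        obtain ⟨h, x⟩ := p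
        have : (h⁻¹ * (QuotientGroup.mk h : H ⧸ φ.range).out) ∈ φ.range := by
          rw [← QuotientGroup.eq, QuotientGroup.out_eq']
        obtain ⟨g, hg⟩ := this
        refine ⟨⟨QuotientGroup.mk h, Z.act g⁻¹ x⟩, ?_⟩
        refine (Z.indMk_eq_iff φ _ _ _ _).2 ⟨g, ?_, ?_⟩
        · rw [hg]
          group
        · simp)).symm

theorem indEquiv_symm (Z : GVar G) (φ : G →* H) (hφ : Function.Injective φ)
    (c : H ⧸ φ.range) (x : Z.X.carrier) :
    (Z.indEquiv φ hφ).symm ⟨c, x⟩ = Z.indMk φ c.out x := rfl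

/-- On the underlying set of the induced variety, `H` acts by left multiplication. -/
def indAct (Z : GVar G) (φ : G →* H) (k : H) : Z.IndCarrier φ → Z.IndCarrier φ :=
  Quotient.map' (s₁ := Z.indRel φ) (s₂ := Z.indRel φ) (fun p => (k * p.1, p.2)) (by
    rintro p q ⟨g, h1, h2⟩
    exact ⟨g, by simp [h1, mul_assoc], h2⟩)

theorem indAct_mk (Z : GVar G) (φ : G →* H) (k h : H) (x : Z.X.carrier) :
    Z.indAct φ k (Z.indMk φ h x) = Z.indMk φ (k * h) x := rfl

variable [Finite H]

/-- The quasi-projective variety underlying the induced variety. -/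
noncomputable def indVar (Z : GVar G) (φ : G →* H) (hφ : Function.Injective φ) :
    QPVar :=
  (QPVar.sigma (fun _ : H ⧸ φ.range => Z.X)).transport (Z.indEquiv φ hφ)

theorem isMor_indMk (Z : GVar G) (φ : G →* H) (hφ : Function.Injective φ) (h : H) :
    IsMor Z.X (Z.indVar φ hφ) (Z.indMk φ h) := by
  refine isMor_to_transport _ _ ?_
  have : (h⁻¹ * (QuotientGroup.mk h : H ⧸ φ.range).out) ∈ φ.range := by
    rw [← QuotientGroup.eq, QuotientGroup.out_eq']
  obtain ⟨g, hg⟩ := this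
  have h2 := (isMor_sigmaMk (fun _ : H ⧸ φ.range => Z.X) (QuotientGroup.mk h)).comp (Z.mor g⁻¹)
  convert h2 using 1
  funext x
  rw [← Equiv.eq_symm_apply]
  refine ((Z.indMk_eq_iff φ _ _ _ _).2 ⟨g⁻¹, ?_, rfl⟩)
  change (QuotientGroup.mk h : H ⧸ φ.range).out = _
  rw [map_inv, hg, inv_inv, mul_inv_cancel_left]

theorem isMor_ind (Z : GVar G) (φ : G →* H) (hφ : Function.Injective φ) {W : QPVar}
    {f : Z.IndCarrier φ → W.carrier} (hf : ∀ h, IsMor Z.X W (fun x => f (Z.indMk φ h x))) :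
    IsMor (Z.indVar φ hφ) W f := by
  have h1 : IsMor (QPVar.sigma (fun _ : H ⧸ φ.range => Z.X)) W
      (fun p => f ((Z.indEquiv φ hφ).symm p)) := isMor_sigma _ fun c => hf c.out
  have h2 := h1.comp (isMor_transport _ (Z.indEquiv φ hφ))
  have h3 : (fun p => f ((Z.indEquiv φ hφ).symm p)) ∘ (Z.indEquiv φ hφ) = f := by
    funext x
    simp
  rwa [h3] at h2

/-- The induced `H`-variety `ind_G^H Z = (H × Z) / ∼`, where `G` is regarded as a subgroup of `H`
through the embedding `φ`. As a variety it is a disjoint union of copies of `Z`, one for each coset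
in `H / G`, the maps `x ↦ [(h, x)]` being isomorphisms onto these copies. -/
@[reducible] noncomputable def ind (Z : GVar G) (φ : G →* H) (hφ : Function.Injective φ) : GVar H :=
  ofMaps (Z.indVar φ hφ) (Z.indAct φ)
    (fun x => by
      induction x using Quotient.inductionOn with
      | h p => exact (Z.indAct_mk φ 1 p.1 p.2).trans (by rw [one_mul]; rfl))
    (fun g h x => by
      induction x using Quotient.inductionOn with
      | h p =>
        change Z.indMk φ (g * h * p.1) p.2 = Z.indMk φ (g * (h * p.1)) p.2
        rw [mul_assoc])
    (fun g => Z.isMor_ind φ hφ fun h => Z.isMor_indMk φ hφ (g * h))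

end ind

end GVar

/-! ### Varieties with finite groups actions -/

/-- Isomorphisms onto locally closed subvarieties. -/
def IsImm (X Y : QPVar) (f : X.carrier → Y.carrier) : Prop :=
  ∃ (S : Set Y.carrier) (hS : Y.IsLC S) (e : X.carrier ≃ S),
    IsMor X (Y.sub S hS) e ∧ IsMor (Y.sub S hS) X e.symm ∧ ∀ x, (e x : Y.carrier) = f x

theorem IsImm.isMor {X Y : QPVar} {f : X.carrier → Y.carrier} (h : IsImm X Y f) :
    IsMor X Y f := by
  obtain ⟨S, hS, e, h1, -, h3⟩ := h
  rw [← show (fun x => (e x : Y.carrier)) = f from funext h3]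
  exact (isMor_val Y S hS).comp h1

theorem IsImm.restrict {X Y : QPVar} {f : X.carrier → Y.carrier} (h : IsImm X Y f)
    {S : Set Y.carrier} (hS : Y.IsLC S) :
    IsImm (X.sub {x | f x ∈ S} (h.isMor.lc_preimage hS)) (Y.sub S hS) (fun x => ⟨f x.1, x.2⟩) := by
  have hf := h.isMor
  obtain ⟨T, hT, e, h1, h2, h3⟩ := h
  have hT' : (Y.sub S hS).IsLC (Subtype.val ⁻¹' T) := (isMor_val Y S hS).lc_preimage hT
  have hTe : ∀ y, f (e.symm y) = y.1 := fun y => by rw [← h3, Equiv.apply_symm_apply]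
  refine ⟨Subtype.val ⁻¹' T, hT',
    { toFun := fun x => ⟨⟨f x.1, x.2⟩, by
        change f x.1 ∈ T
        rw [← h3]
        exact (e x.1).2⟩
      invFun := fun y => ⟨e.symm ⟨y.1.1, y.2⟩, by
        change f _ ∈ S
        rw [hTe]
        exact y.1.2⟩
      left_inv := fun x => Subtype.ext (by
        change e.symm ⟨f x.1, _⟩ = x.1
        rw [Equiv.symm_apply_eq]
        exact Subtype.ext (h3 x.1).symm)
      right_inv := fun y => Subtype.ext (Subtype.ext (hTe _)) }, ?_, ?_, fun x => rfl⟩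
  · refine isMor_codRestrict hT' (isMor_codRestrict hS ?_)
    exact hf.comp (isMor_val _ _ _)
  · have h4 : IsMor ((Y.sub S hS).sub _ hT') (Y.sub T hT) (fun y => ⟨y.1.1, y.2⟩) :=
      isMor_codRestrict hT ((isMor_val Y S hS).comp (isMor_val _ _ hT'))
    exact isMor_codRestrict _ (h2.comp h4)

theorem IsImm.of_inverse {X Y : QPVar} {f : X.carrier → Y.carrier} (S : Set Y.carrier)
    (hS : Y.IsLC S) (hf : IsMor X Y f) (hfS : ∀ x, f x ∈ S) (r : S → X.carrier)
    (hr : IsMor (Y.sub S hS) X r) (h1 : ∀ y, f (r y) = y.1) (h2 : ∀ x, r ⟨f x, hfS x⟩ = x) :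
    IsImm X Y f :=
  ⟨S, hS, ⟨fun x => ⟨f x, hfS x⟩, r, h2, fun y => Subtype.ext (h1 y)⟩,
    isMor_codRestrict hS hf, hr, fun _ => rfl⟩

theorem IsImm.prodMap {X Y X' Y' : QPVar} {f : X.carrier → X'.carrier}
    {g : Y.carrier → Y'.carrier} (hf : IsImm X X' f) (hg : IsImm Y Y' g) :
    IsImm (X.prod Y) (X'.prod Y') (fun x => (f x.1, g x.2)) := by
  have hfm := hf.isMor
  have hgm := hg.isMor
  obtain ⟨S, hS, e, h1, h2, h3⟩ := hf
  obtain ⟨T, hT, k, h4, h5, h6⟩ := hg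
  have hST : (X'.prod Y').IsLC (Prod.fst ⁻¹' S ∩ Prod.snd ⁻¹' T) :=
    ((isMor_fst _ _).lc_preimage hS).inter ((isMor_snd _ _).lc_preimage hT)
  have hfS : ∀ x, f x ∈ S := fun x => by
    rw [← h3]
    exact (e x).2
  have hgT : ∀ x, g x ∈ T := fun x => by
    rw [← h6]
    exact (k x).2
  have e1 : ∀ y, f (e.symm y) = y.1 := fun y => by rw [← h3, Equiv.apply_symm_apply]
  have k1 : ∀ y, g (k.symm y) = y.1 := fun y => by rw [← h6, Equiv.apply_symm_apply]
  have e2 : ∀ x, e.symm ⟨f x, hfS x⟩ = x := fun x => by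
    rw [Equiv.symm_apply_eq]
    exact Subtype.ext (h3 x).symm
  have k2 : ∀ x, k.symm ⟨g x, hgT x⟩ = x := fun x => by
    rw [Equiv.symm_apply_eq]
    exact Subtype.ext (h6 x).symm
  have p1 : IsMor ((X'.prod Y').sub _ hST) (X'.sub S hS) (fun y => ⟨y.1.1, y.2.1⟩) :=
    isMor_codRestrict hS ((isMor_fst _ _).comp (isMor_val _ _ hST))
  have p2 : IsMor ((X'.prod Y').sub _ hST) (Y'.sub T hT) (fun y => ⟨y.1.2, y.2.2⟩) :=
    isMor_codRestrict hT ((isMor_snd _ _).comp (isMor_val _ _ hST))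
  refine IsImm.of_inverse _ hST (isMor_prodMap hfm hgm) (fun x => ⟨hfS x.1, hgT x.2⟩)
    (fun y => (e.symm ⟨y.1.1, y.2.1⟩, k.symm ⟨y.1.2, y.2.2⟩)) ?_ ?_ ?_
  · exact isMor_prodMk (h2.comp p1) (h5.comp p2)
  · exact fun y => Prod.ext (e1 _) (k1 _)
  · exact fun x => Prod.ext (e2 _) (k2 _)

/-- A quasi-projective variety with a finite groups action: a variety `ambient` represented as the
disjoint union of finitely many locally closed subvarieties (the images of the `piece i`), where the
`i`-th one is endowed with an action of a finite group `G i`. -/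
structure FGVar where
  ambient : QPVar
  I : Type
  [finI : Finite I]
  G : I → Type
  [grp : ∀ i, Group (G i)]
  [finG : ∀ i, Finite (G i)]
  piece : ∀ i, GVar (G i)
  incl : (Σ i, (piece i).X.carrier) ≃ ambient.carrier
  imm : ∀ i, IsImm (piece i).X ambient fun x => incl ⟨i, x⟩

attribute [instance] FGVar.finI FGVar.grp FGVar.finG

namespace FGVar

/-- A partition of a variety with a finite groups action: finite partitions of its components into
locally closed invariant subsets, the fibres of the maps `label i`. -/
structure Partition (𝒳 : FGVar) where
  K : 𝒳.I → Type
  fin : ∀ i, Finite (K i)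
  label : ∀ i, (𝒳.piece i).X.carrier → K i
  lc : ∀ i k, (𝒳.piece i).X.IsLC {x | label i x = k}
  inv : ∀ i k, (𝒳.piece i).Inv {x | label i x = k}

/-- The parts of a partition. -/
@[reducible] noncomputable def Partition.part {𝒳 : FGVar} (P : 𝒳.Partition) (k : Σ i, P.K i) :
    GVar (𝒳.G k.1) :=
  (𝒳.piece k.1).sub {x | P.label k.1 x = k.2} (P.lc k.1 k.2) (P.inv k.1 k.2)

/-- Equivalence of varieties with finite groups actions: they have partitions with pairwise
isomorphic parts. -/
def Equivalent (𝒳 𝒴 : FGVar) : Prop :=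
  ∃ (P : 𝒳.Partition) (Q : 𝒴.Partition) (e : (Σ i, P.K i) ≃ (Σ j, Q.K j)),
    ∀ k, Isomorphic (P.part k) (Q.part (e k))

/-- A subset invariant with respect to the groups actions. -/
def Inv (𝒳 : FGVar) (S : Set 𝒳.ambient.carrier) : Prop :=
  ∀ i, (𝒳.piece i).Inv {x | 𝒳.incl ⟨i, x⟩ ∈ S}

theorem Inv.compl {𝒳 : FGVar} {S : Set 𝒳.ambient.carrier} (h : 𝒳.Inv S) : 𝒳.Inv Sᶜ :=
  fun i => (h i).compl

/-- An invariant locally closed subset, with the induced finite groups action. -/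
@[reducible] noncomputable def restrict (𝒳 : FGVar) (S : Set 𝒳.ambient.carrier)
    (hS : 𝒳.ambient.IsLC S) (hi : 𝒳.Inv S) : FGVar where
  ambient := 𝒳.ambient.sub S hS
  I := 𝒳.I
  G := 𝒳.G
  piece i := (𝒳.piece i).sub {x | 𝒳.incl ⟨i, x⟩ ∈ S} ((𝒳.imm i).isMor.lc_preimage hS) (hi i)
  incl := Equiv.ofBijective (fun x => ⟨𝒳.incl ⟨x.1, x.2.1⟩, x.2.2⟩) (by
    constructor
    · rintro ⟨i, x, hx⟩ ⟨j, y, hy⟩ h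
      have h := 𝒳.incl.injective (congrArg Subtype.val h)
      simp only [Sigma.mk.injEq] at h
      obtain ⟨rfl, h⟩ := h
      simp only [heq_eq_eq] at h
      subst h
      rfl
    · rintro ⟨y, hy⟩
      obtain ⟨⟨i, x⟩, rfl⟩ := 𝒳.incl.surjective y
      exact ⟨⟨i, x, hy⟩, rfl⟩)
  imm i := (𝒳.imm i).restrict hS

/-- A variety with a pure action, that is, with an action of one finite group. -/
@[reducible] noncomputable def pure {G : Type} [Group G] [Finite G] (Z : GVar G) : FGVar where
  ambient := Z.X
  I := Unit
  G _ := G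
  piece _ := Z
  incl := Equiv.uniqueSigma _
  imm _ := ⟨Set.univ, Z.X.isLC_univ, (Equiv.Set.univ _).symm, IsMor.id _, isMor_val _ _ _,
    fun _ => rfl⟩

/-- The Cartesian product: it is the disjoint union of the products of the components, with the
actions of the products of the groups. -/
@[reducible] noncomputable def prod (𝒳 𝒴 : FGVar) : FGVar where
  ambient := 𝒳.ambient.prod 𝒴.ambient
  I := 𝒳.I × 𝒴.I
  G i := 𝒳.G i.1 × 𝒴.G i.2
  piece i := (𝒳.piece i.1).prod (𝒴.piece i.2)
  incl :=
    { toFun := fun x => (𝒳.incl ⟨x.1.1, x.2.1⟩, 𝒴.incl ⟨x.1.2, x.2.2⟩)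
      invFun := fun y => ⟨((𝒳.incl.symm y.1).1, (𝒴.incl.symm y.2).1),
        ((𝒳.incl.symm y.1).2, (𝒴.incl.symm y.2).2)⟩
      left_inv := by
        rintro ⟨⟨i, j⟩, x, y⟩
        dsimp only
        rw [𝒳.incl.symm_apply_apply, 𝒴.incl.symm_apply_apply]
      right_inv := fun y => by
        ext
        · exact 𝒳.incl.apply_symm_apply y.1
        · exact 𝒴.incl.apply_symm_apply y.2 }
  imm i := (𝒳.imm i.1).prodMap (𝒴.imm i.2)

end FGVar

/-! ### The Grothendieck ring -/

open FreeAbelianGroup (of)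

/-- The relations defining the Grothendieck ring. -/
inductive Relator : FreeAbelianGroup FGVar → Prop
  | equivalent (𝒳 𝒴 : FGVar) (h : 𝒳.Equivalent 𝒴) : Relator (of 𝒳 - of 𝒴)
  | closed (𝒳 : FGVar) (Y : Set 𝒳.ambient.carrier) (hY : IsClosed[𝒳.ambient.top] Y)
      (hi : 𝒳.Inv Y) :
      Relator (of 𝒳 - (of (𝒳.restrict Y (QPVar.isLC_of_isClosed hY) hi) +
        of (𝒳.restrict Yᶜ (QPVar.isLC_compl hY) hi.compl)))
  | ind {G H : Type} [Group G] [Finite G] [Group H] [Finite H] (φ : G →* H)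
      (hφ : Function.Injective φ) (Z : GVar G) :
      Relator (of (FGVar.pure (Z.ind φ hφ)) - of (FGVar.pure Z))

/-- The Grothendieck ring of complex quasi-projective varieties with finite groups actions
(as an Abelian group; the multiplication is defined below). -/
def K0 : Type 1 := FreeAbelianGroup FGVar ⧸ AddSubgroup.closure {r | Relator r}

noncomputable instance : AddCommGroup K0 :=
  inferInstanceAs (AddCommGroup (FreeAbelianGroup FGVar ⧸ AddSubgroup.closure {r | Relator r}))

/-- The class of a variety with a finite groups action. -/
noncomputable def cls (𝒳 : FGVar) : K0 :=
  QuotientAddGroup.mk' (AddSubgroup.closure {r | Relator r}) (of 𝒳)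

/-- Additive maps out of the Grothendieck ring agree if they agree on classes. -/
theorem K0.induction {p : K0 → Prop} (h0 : p 0) (hc : ∀ 𝒳, p (cls 𝒳)) (hn : ∀ a, p a → p (-a))
    (ha : ∀ a b, p a → p b → p (a + b)) (a : K0) : p a := by
  obtain ⟨x, rfl⟩ := QuotientAddGroup.mk'_surjective _ a
  induction x using FreeAbelianGroup.induction_on with
  | zero => exact h0
  | of x => exact hc x
  | neg x h => exact hn _ h
  | add x y hx hy => exact ha _ _ hx hy

theorem mk_relator {r : FreeAbelianGroup FGVar} (h : Relator r) :
    (QuotientAddGroup.mk' (AddSubgroup.closure {r | Relator r}) r :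
      FreeAbelianGroup FGVar ⧸ AddSubgroup.closure {r | Relator r}) = 0 :=
  (QuotientAddGroup.eq_zero_iff r).2 (AddSubgroup.subset_closure h)

theorem cls_eq {𝒳 𝒴 : FGVar} (h : 𝒳.Equivalent 𝒴) : cls 𝒳 = cls 𝒴 := by
  have := mk_relator (.equivalent 𝒳 𝒴 h)
  rw [map_sub, sub_eq_zero] at this
  exact this

theorem cls_closed (𝒳 : FGVar) (Y : Set 𝒳.ambient.carrier) (hY : IsClosed[𝒳.ambient.top] Y)
    (hi : 𝒳.Inv Y) : cls 𝒳 = cls (𝒳.restrict Y (QPVar.isLC_of_isClosed hY) hi) +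
      cls (𝒳.restrict Yᶜ (QPVar.isLC_compl hY) hi.compl) := by
  have := mk_relator (.closed 𝒳 Y hY hi)
  rw [map_sub, sub_eq_zero, map_add] at this
  exact this

theorem cls_ind {G H : Type} [Group G] [Finite G] [Group H] [Finite H] (φ : G →* H)
    (hφ : Function.Injective φ) (Z : GVar G) :
    cls (FGVar.pure (Z.ind φ hφ)) = cls (FGVar.pure Z) := by
  have := mk_relator (.ind φ hφ Z)
  rw [map_sub, sub_eq_zero] at this
  exact this

namespace Isomorphic

variable {G H K G' H' : Type} [Group G] [Group H] [Group K] [Group G'] [Group H']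

theorem refl (Z : GVar G) : Isomorphic Z Z :=
  ⟨MulEquiv.refl G, Equiv.refl _, IsMor.id _, IsMor.id _, fun _ _ => rfl⟩

theorem of_maps {Z : GVar G} {W : GVar H} (φ : G ≃* H) (F : Z.X.carrier → W.X.carrier)
    (R : W.X.carrier → Z.X.carrier) (hF : IsMor Z.X W.X F) (hR : IsMor W.X Z.X R)
    (h1 : ∀ x, R (F x) = x) (h2 : ∀ y, F (R y) = y)
    (h3 : ∀ g x, F (Z.act g x) = W.act (φ g) (F x)) : Isomorphic Z W :=
  ⟨φ, ⟨F, R, h1, h2⟩, hF, hR, h3⟩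

theorem symm {Z : GVar G} {W : GVar H} (h : Isomorphic Z W) : Isomorphic W Z := by
  obtain ⟨φ, ψ, h1, h2, h3⟩ := h
  refine ⟨φ.symm, ψ.symm, h2, h1, fun g x => ?_⟩
  rw [Equiv.symm_apply_eq, h3, MulEquiv.apply_symm_apply, Equiv.apply_symm_apply]

theorem trans {Z : GVar G} {W : GVar H} {V : GVar K} (h : Isomorphic Z W)
    (h' : Isomorphic W V) : Isomorphic Z V := by
  obtain ⟨φ, ψ, h1, h2, h3⟩ := h
  obtain ⟨φ', ψ', h1', h2', h3'⟩ := h'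
  exact ⟨φ.trans φ', ψ.trans ψ', h1'.comp h1, h2.comp h2', fun g x => by simp [h3, h3']⟩

theorem sub_univ (Z : GVar G) (S : Set Z.X.carrier) (hS : Z.X.IsLC S) (hi : Z.Inv S)
    (h : ∀ x, x ∈ S) : Isomorphic (Z.sub S hS hi) Z :=
  ⟨MulEquiv.refl G, Equiv.subtypeUnivEquiv h, isMor_val _ _ hS, isMor_codRestrict hS (IsMor.id _),
    fun _ _ => rfl⟩

theorem sub_sub (Z : GVar G) (S : Set Z.X.carrier) (hS : Z.X.IsLC S) (hi : Z.Inv S)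
    (T : Set S) (hT : (Z.sub S hS hi).X.IsLC T) (hT' : (Z.sub S hS hi).Inv T)
    (R : Set Z.X.carrier) (hR : Z.X.IsLC R) (hR' : Z.Inv R)
    (h : ∀ x, x ∈ R ↔ ∃ h : x ∈ S, (⟨x, h⟩ : S) ∈ T) :
    Isomorphic ((Z.sub S hS hi).sub T hT hT') (Z.sub R hR hR') := by
  refine ⟨MulEquiv.refl G, ⟨fun x => ⟨x.1.1, (h _).2 ⟨x.1.2, x.2⟩⟩,
    fun x => ⟨⟨x.1, ((h _).1 x.2).1⟩, ((h _).1 x.2).2⟩, fun _ => rfl, fun _ => rfl⟩, ?_, ?_,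
    fun _ _ => rfl⟩
  · exact isMor_codRestrict hR ((isMor_val _ _ hS).comp (isMor_val _ _ hT))
  · exact isMor_codRestrict hT (isMor_codRestrict hS (isMor_val _ _ hR))

theorem prod {Z : GVar G} {W : GVar H} {Z' : GVar G'} {W' : GVar H'} (h : Isomorphic Z Z')
    (h' : Isomorphic W W') : Isomorphic (Z.prod W) (Z'.prod W') := by
  obtain ⟨φ, ψ, h1, h2, h3⟩ := h
  obtain ⟨φ', ψ', h1', h2', h3'⟩ := h'
  exact ⟨φ.prodCongr φ', ψ.prodCongr ψ', isMor_prodMap h1 h1', isMor_prodMap h2 h2',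
    fun g x => Prod.ext (h3 _ _) (h3' _ _)⟩

theorem prod_comm (Z : GVar G) (W : GVar H) : Isomorphic (Z.prod W) (W.prod Z) :=
  ⟨MulEquiv.prodComm, Equiv.prodComm _ _, isMor_prodMk (isMor_snd _ _) (isMor_fst _ _),
    isMor_prodMk (isMor_snd _ _) (isMor_fst _ _), fun _ _ => rfl⟩

theorem prod_assoc (Z : GVar G) (W : GVar H) (V : GVar K) :
    Isomorphic ((Z.prod W).prod V) (Z.prod (W.prod V)) :=
  ⟨MulEquiv.prodAssoc, Equiv.prodAssoc _ _ _,
    isMor_prodMk ((isMor_fst _ _).comp (isMor_fst _ _))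
      (isMor_prodMk ((isMor_snd _ _).comp (isMor_fst _ _)) (isMor_snd _ _)),
    isMor_prodMk (isMor_prodMk (isMor_fst _ _) ((isMor_fst _ _).comp (isMor_snd _ _)))
      ((isMor_snd _ _).comp (isMor_snd _ _)), fun _ _ => rfl⟩

theorem prod_sub (Z : GVar G) (W : GVar H) (T : Set W.X.carrier) (hT : W.X.IsLC T)
    (hi : W.Inv T) (S : Set (Z.X.carrier × W.X.carrier)) (hS : (Z.prod W).X.IsLC S)
    (hi' : (Z.prod W).Inv S) (h : ∀ x, x ∈ S ↔ x.2 ∈ T) :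
    Isomorphic ((Z.prod W).sub S hS hi') (Z.prod (W.sub T hT hi)) := by
  have hc : IsMor ((Z.prod W).X.sub S hS) (W.X.sub T hT) (fun x => ⟨x.1.2, (h _).1 x.2⟩) :=
    isMor_codRestrict hT ((isMor_snd _ _).comp (isMor_val _ _ hS))
  refine ⟨MulEquiv.refl _, ⟨fun x => (x.1.1, ⟨x.1.2, (h _).1 x.2⟩),
    fun x => ⟨(x.1, x.2.1), (h _).2 x.2.2⟩, fun _ => rfl, fun _ => rfl⟩, ?_, ?_, fun _ _ => rfl⟩
  · exact isMor_prodMk ((isMor_fst _ _).comp (isMor_val _ _ hS)) hc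
  · exact isMor_codRestrict hS (isMor_prodMk (isMor_fst _ _)
      ((isMor_val _ _ hT).comp (isMor_snd _ _)))

theorem isMor_const (X Y : QPVar) (y : Y.carrier) : IsMor X Y (fun _ => y) := fun _ =>
  ⟨Set.univ, @isOpen_univ _ X.top, trivial, 0, fun j => C (Y.coord y j),
    fun j => isHomogeneous_C _ _, fun _ _ => ⟨1, one_ne_zero, fun j => by rw [eval_C, one_mul]⟩⟩

theorem point_prod (Z : GVar G) : Isomorphic (GVar.point.prod Z) Z :=
  ⟨MulEquiv.uniqueProd, Equiv.uniqueProd _ _, isMor_snd _ _,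
    isMor_prodMk (isMor_const _ _ _) (IsMor.id _), fun _ _ => rfl⟩

theorem isOpen_component {I : Type} [Finite I] (X : I → QPVar) (i : I) :
    IsOpen[(QPVar.sigma X).top] {y : Σ i, (X i).carrier | y.1 = i} := by
  classical
  let := (QPVar.sigma X).top
  have : {y : Σ i, (X i).carrier | y.1 = i} = ⋃ a : (X i).ι,
      {y : Σ i, (X i).carrier | eval (QPVar.sigmaCoord X y)
        (MvPolynomial.X (⟨i, a⟩ : Σ i, (X i).ι)) ≠ 0} := by
    ext ⟨j, y⟩
    simp only [Set.mem_ofPred_eq, Set.mem_iUnion, eval_X]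
    constructor
    · rintro rfl
      obtain ⟨a, ha⟩ := (X j).coord_exists y
      exact ⟨a, by rwa [QPVar.sigmaCoord_self]⟩
    · rintro ⟨a, ha⟩
      by_contra hj
      exact ha (QPVar.sigmaCoord_of_ne X j y i (Ne.symm hj) a)
  rw [this]
  exact isOpen_iUnion fun a => (QPVar.sigma X).isOpen_ne (isHomogeneous_X ℂ _)

open Classical in
/-- A morphism from a disjoint union to a summand which is the identity on it. -/
noncomputable def retract {I : Type} (X : I → QPVar) (i : I) (x : (X i).carrier)
    (y : Σ i, (X i).carrier) : (X i).carrier :=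
  if h : y.1 = i then h ▸ y.2 else x

theorem retract_self {I : Type} (X : I → QPVar) (i : I) (x y : (X i).carrier) :
    retract X i x ⟨i, y⟩ = y := by
  simp [retract]

theorem isMor_retract {I : Type} [Finite I] (X : I → QPVar) (i : I) (x : (X i).carrier) :
    IsMor (QPVar.sigma X) (X i) (retract X i x) := by
  refine isMor_sigma X fun j => ?_
  by_cases h : j = i
  · subst h
    have : (fun y => retract X j x ⟨j, y⟩) = id := funext fun y => retract_self X j x y
    rw [this]
    exact IsMor.id _
  · have : (fun y => retract X i x ⟨j, y⟩) = fun _ => x := funext fun y => by simp [retract, h]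
    rw [this]
    exact isMor_const _ _ _

theorem isMor_prod_sigma {I : Type} [Finite I] (A : QPVar) (X : I → QPVar) {W : QPVar}
    {f : A.carrier × (Σ i, (X i).carrier) → W.carrier}
    (hf : ∀ i, IsMor (A.prod (X i)) W (fun p => f (p.1, ⟨i, p.2⟩))) :
    IsMor (A.prod (QPVar.sigma X)) W f := by
  refine IsMor.congr_local ?_
  rintro ⟨a, i, x⟩
  let := (A.prod (QPVar.sigma X)).top
  let := (QPVar.sigma X).top
  refine ⟨Prod.snd ⁻¹' {y : Σ i, (X i).carrier | y.1 = i},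
    (isOpen_component X i).preimage (isMor_snd A (QPVar.sigma X)).continuous, rfl,
    (fun p => f (p.1, ⟨i, p.2⟩)) ∘ (fun p => (p.1, retract X i x p.2)),
    (hf i).comp (isMor_prodMk (isMor_fst _ _) ((isMor_retract X i x).comp (isMor_snd _ _))), ?_⟩
  rintro ⟨b, j, y⟩ (rfl : j = i)
  simp only [Function.comp_apply, retract_self]

theorem isMor_prod_ind [Finite H] (A : QPVar) (Z : GVar G) (φ : G →* H)
    (hφ : Function.Injective φ) {W : QPVar} {f : A.carrier × Z.IndCarrier φ → W.carrier}
    (hf : ∀ h, IsMor (A.prod Z.X) W (fun p => f (p.1, Z.indMk φ h p.2))) :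
    IsMor (A.prod (Z.indVar φ hφ)) W f := by
  have h1 : IsMor (A.prod (QPVar.sigma (fun _ : H ⧸ φ.range => Z.X))) W
      (fun p => f (p.1, (Z.indEquiv φ hφ).symm p.2)) := isMor_prod_sigma _ _ fun c => hf c.out
  have h2 := h1.comp (isMor_prodMap (IsMor.id A) (isMor_transport _ (Z.indEquiv φ hφ)))
  have h3 : (fun p : A.carrier × _ => f (p.1, (Z.indEquiv φ hφ).symm p.2)) ∘
      (Prod.map id (Z.indEquiv φ hφ)) = f := by
    funext x
    simp
  rwa [h3] at h2

theorem prodInd_injective {φ : G →* H} (hφ : Function.Injective φ) :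
    Function.Injective ((MonoidHom.id K).prodMap φ) :=
  Function.injective_id.prodMap hφ

theorem prod_ind [Finite H] [Finite K] (A : GVar K) (Z : GVar G) (φ : G →* H)
    (hφ : Function.Injective φ) : Isomorphic (A.prod (Z.ind φ hφ))
      ((A.prod Z).ind ((MonoidHom.id K).prodMap φ) (prodInd_injective hφ)) := by
  obtain ⟨F, hF⟩ : ∃ F : A.X.carrier × Z.IndCarrier φ →
      (A.prod Z).IndCarrier ((MonoidHom.id K).prodMap φ),
      ∀ a h z, F (a, Z.indMk φ h z) = (A.prod Z).indMk _ (1, h) (a, z) := by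
    refine ⟨fun p => Quotient.liftOn (s := Z.indRel φ) p.2
      (fun q => (A.prod Z).indMk ((MonoidHom.id K).prodMap φ) (1, q.1) (p.1, q.2)) ?_,
      fun _ _ _ => rfl⟩
    rintro ⟨h, x⟩ ⟨k, y⟩ ⟨g, h1, h2⟩
    refine (GVar.indMk_eq_iff _ _ _ _ _ _).2 ⟨(1, g), ?_, ?_⟩
    · exact Prod.ext (by simp) (by simpa using h1)
    · exact Prod.ext (by simp) (by simpa using h2)
  obtain ⟨R, hR⟩ : ∃ R : (A.prod Z).IndCarrier ((MonoidHom.id K).prodMap φ) →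
      A.X.carrier × Z.IndCarrier φ,
      ∀ k h a z, R ((A.prod Z).indMk _ (k, h) (a, z)) = (A.act k a, Z.indMk φ h z) := by
    refine ⟨fun p => Quotient.liftOn (s := (A.prod Z).indRel ((MonoidHom.id K).prodMap φ)) p
      (fun q => (A.act q.1.1 q.2.1, Z.indMk φ q.1.2 q.2.2)) ?_, fun _ _ _ _ => rfl⟩
    rintro ⟨⟨a, h⟩, x, z⟩ ⟨⟨b, k⟩, y, w⟩ ⟨⟨c, g⟩, h1, h2⟩
    have h3 := congrArg Prod.fst h1
    have h4 := congrArg Prod.snd h1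
    have h5 := congrArg Prod.fst h2
    have h6 := congrArg Prod.snd h2
    refine Prod.ext ?_ ((GVar.indMk_eq_iff _ _ _ _ _ _).2 ⟨g, h4, h6⟩)
    change b = a * c⁻¹ at h3
    change y = A.act c x at h5
    change A.act a x = A.act b y
    rw [h3, h5]
    simp
  have hact : ∀ (k : K) (h : H) (a : A.X.carrier) (z : Z.X.carrier),
      (A.prod Z).indMk ((MonoidHom.id K).prodMap φ) (k, h) (a, z) =
        (A.prod Z).indMk ((MonoidHom.id K).prodMap φ) (1, h) (A.act k a, z) := by
    intro k h a z
    refine (GVar.indMk_eq_iff _ _ _ _ _ _).2 ⟨(k, 1), ?_, ?_⟩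
    · exact Prod.ext (by simp) (by simp)
    · exact Prod.ext rfl (by simp)
  have m0 : ∀ h, IsMor (A.X.prod Z.X) ((A.prod Z).indVar _ (prodInd_injective hφ))
      (fun p => F (p.1, Z.indMk φ h p.2)) := fun h => by
    simp only [hF]
    exact (A.prod Z).isMor_indMk _ (prodInd_injective hφ) (1, h)
  have m1 : IsMor (A.X.prod (Z.indVar φ hφ)) ((A.prod Z).indVar _ (prodInd_injective hφ)) F :=
    isMor_prod_ind A.X Z φ hφ m0
  have m2 : IsMor ((A.prod Z).indVar _ (prodInd_injective hφ)) (A.X.prod (Z.indVar φ hφ)) R := by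
    refine (A.prod Z).isMor_ind _ (prodInd_injective hφ) fun k => ?_
    exact (isMor_prodMap (A.mor k.1) (Z.isMor_indMk φ hφ k.2)).congr fun x => (hR _ _ _ _).symm
  refine of_maps (MulEquiv.refl _) F R m1 m2 ?_ ?_ ?_
  · rintro ⟨a, q⟩
    induction q using Quotient.inductionOn with
    | h q =>
      refine (congrArg R (hF a q.1 q.2)).trans ((hR _ _ _ _).trans ?_)
      exact Prod.ext (A.act_one a) rfl
  · intro q
    induction q using Quotient.inductionOn with
    | h q =>
      obtain ⟨⟨k, h⟩, a, z⟩ := q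
      exact (congrArg F (hR k h a z)).trans ((hF _ _ _).trans (hact k h a z).symm)
  · rintro ⟨k, h⟩ ⟨a, q⟩
    induction q using Quotient.inductionOn with
    | h q =>
      obtain ⟨h', z⟩ := q
      have h1 := hact (k * 1) (h * h') a z
      have h2 : F (A.act k a, Z.indMk φ (h * h') z) =
          (A.prod Z).indMk ((MonoidHom.id K).prodMap φ) (k * 1, h * h') (a, z) := by
        rw [hF, h1, mul_one]
      refine h2.trans ?_
      exact (congrArg ((A.prod Z).indAct ((MonoidHom.id K).prodMap φ) (k, h)) (hF a h' z)).symm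

end Isomorphic

namespace FGVar

/-- Varieties with finite groups actions are equivalent if their non-empty components are pairwise
isomorphic. -/
theorem equivalent_of_pieces {𝒳 𝒴 : FGVar}
    (e : {i // Nonempty (𝒳.piece i).X.carrier} ≃ {j // Nonempty (𝒴.piece j).X.carrier})
    (h : ∀ i, Isomorphic (𝒳.piece i.1) (𝒴.piece (e i).1)) : 𝒳.Equivalent 𝒴 := by
  let P : ∀ 𝒵 : FGVar, 𝒵.Partition := fun 𝒵 =>
    { K := fun i => {_u : Unit // Nonempty (𝒵.piece i).X.carrier}
      fin := fun i => inferInstance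
      label := fun i x => ⟨(), ⟨x⟩⟩
      lc := fun i k => by
        convert QPVar.isLC_univ _ using 1
        exact Set.eq_univ_of_forall fun x => Subsingleton.elim _ _
      inv := fun i k g x _ => Subsingleton.elim _ _ }
  let E : ∀ 𝒵 : FGVar, (Σ i, (P 𝒵).K i) ≃ {i // Nonempty (𝒵.piece i).X.carrier} := fun 𝒵 =>
    { toFun := fun k => ⟨k.1, k.2.2⟩
      invFun := fun i => ⟨i.1, (), i.2⟩
      left_inv := fun _ => rfl
      right_inv := fun _ => rfl }
  refine ⟨P 𝒳, P 𝒴, ((E 𝒳).trans e).trans (E 𝒴).symm, fun k => ?_⟩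
  refine (Isomorphic.sub_univ _ _ _ _ fun x => Subsingleton.elim _ _).trans ?_
  refine (h (E 𝒳 k)).trans (Isomorphic.symm ?_)
  exact Isomorphic.sub_univ _ _ _ _ fun x => Subsingleton.elim _ _

theorem equivalent_of_pieces' {𝒳 𝒴 : FGVar} (e : 𝒳.I ≃ 𝒴.I)
    (h : ∀ i, Isomorphic (𝒳.piece i) (𝒴.piece (e i))) : 𝒳.Equivalent 𝒴 := by
  refine equivalent_of_pieces (e.subtypeEquiv fun i => ?_) fun i => h i.1
  obtain ⟨-, ψ, -⟩ := h i
  exact ψ.nonempty_congr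

/-- The disjoint union of a family of varieties with pure actions. -/
@[reducible] noncomputable def disj {I : Type} [Finite I] (G : I → Type) [∀ i, Group (G i)]
    [∀ i, Finite (G i)] (Z : ∀ i, GVar (G i)) : FGVar where
  ambient := QPVar.sigma fun i => (Z i).X
  I := I
  G := G
  piece := Z
  incl := Equiv.refl _
  imm i := by
    have hS : (QPVar.sigma fun i => (Z i).X).IsLC {y : Σ i, (Z i).X.carrier | y.1 = i} :=
      QPVar.isLC_of_isOpen (Isomorphic.isOpen_component _ i)
    refine IsImm.of_inverse {y : Σ i, (Z i).X.carrier | y.1 = i} hS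
      (isMor_sigmaMk (fun i => (Z i).X) i) (fun x => rfl) (fun y => y.2 ▸ y.1.2) ?_ ?_ ?_
    · refine IsMor.congr_local fun y => ⟨Set.univ, @isOpen_univ _ (QPVar.top _), trivial,
        fun z => Isomorphic.retract (fun i => (Z i).X) i (y.2 ▸ y.1.2) z.1,
        (Isomorphic.isMor_retract (fun i => (Z i).X) i _).comp (isMor_val _ _ hS), fun z _ => ?_⟩
      obtain ⟨⟨j, z⟩, (rfl : j = i)⟩ := z
      exact (Isomorphic.retract_self (fun i => (Z i).X) j _ z).symm
    · rintro ⟨⟨j, z⟩, (rfl : j = i)⟩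
      rfl
    · exact fun x => rfl

theorem cls_of_isEmpty (𝒳 : FGVar) (h : ∀ i, IsEmpty (𝒳.piece i).X.carrier) : cls 𝒳 = 0 := by
  have hY : IsClosed[𝒳.ambient.top] (∅ : Set 𝒳.ambient.carrier) :=
    @isClosed_empty _ 𝒳.ambient.top
  have hi : 𝒳.Inv ∅ := fun i g x hx => hx.elim
  have key : ∀ (S : Set 𝒳.ambient.carrier) (hS : 𝒳.ambient.IsLC S) (hi : 𝒳.Inv S),
      cls (𝒳.restrict S hS hi) = cls 𝒳 := by
    intro S hS hi
    refine cls_eq (equivalent_of_pieces' (Equiv.refl _) fun i => ?_)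
    exact Isomorphic.sub_univ _ _ _ (hi i) fun x => (h i).elim x
  have := cls_closed 𝒳 ∅ hY hi
  rw [key, key] at this
  simpa using this

theorem cls_decomp {I : Type} [Fintype I] (G : I → Type) [∀ i, Group (G i)]
    [∀ i, Finite (G i)] (Z : ∀ i, GVar (G i)) :
    cls (disj G Z) = ∑ i, cls (pure (Z i)) := by
  classical
  have hopen : ∀ A : Set I, IsOpen[(QPVar.sigma fun i => (Z i).X).top]
      {y : Σ i, (Z i).X.carrier | y.1 ∈ A} := fun A => by
    let := (QPVar.sigma fun i => (Z i).X).top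
    have : {y : Σ i, (Z i).X.carrier | y.1 ∈ A} = ⋃ i ∈ A, {y | y.1 = i} := by
      ext y
      simp
    rw [this]
    exact isOpen_biUnion fun i _ => Isomorphic.isOpen_component _ i
  have hlc : ∀ A : Set I, (disj G Z).ambient.IsLC {y : Σ i, (Z i).X.carrier | y.1 ∈ A} :=
    fun A => QPVar.isLC_of_isOpen (hopen A)
  have hinv : ∀ A : Set I, (disj G Z).Inv {y : Σ i, (Z i).X.carrier | y.1 ∈ A} :=
    fun A i g x hx => hx
  have key : ∀ s : Finset I, cls ((disj G Z).restrict _ (hlc s) (hinv s)) =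
      ∑ i ∈ s, cls (pure (Z i)) := by
    intro s
    induction s using Finset.induction_on with
    | empty => exact cls_of_isEmpty _ fun i => ⟨fun x => by simpa using x.2⟩
    | insert i s hi ih =>
      rw [Finset.sum_insert hi, ← ih]
      set 𝒱 := (disj G Z).restrict _ (hlc (insert i s : Finset I)) (hinv (insert i s : Finset I))
        with h𝒱
      have hY : IsClosed[𝒱.ambient.top] (Subtype.val ⁻¹' {y : Σ i, (Z i).X.carrier | y.1 = i}) := by
        let := 𝒱.ambient.top
        let := (QPVar.sigma fun i => (Z i).X).top
        have hc : IsClosed {y : Σ i, (Z i).X.carrier | y.1 = i} := ⟨hopen {i}ᶜ⟩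
        exact hc.preimage (isMor_val _ _ (hlc (insert i s : Finset I))).continuous
      have hYi : 𝒱.Inv (Subtype.val ⁻¹' {y : Σ i, (Z i).X.carrier | y.1 = i}) :=
        fun j g x hx => hx
      rw [cls_closed 𝒱 _ hY hYi]
      congr 1
      · have hne : ∀ j, Nonempty ((𝒱.restrict _ (QPVar.isLC_of_isClosed hY) hYi).piece
            j).X.carrier ↔ j = i ∧ Nonempty (Z i).X.carrier := by
          intro j
          constructor
          · rintro ⟨⟨⟨x, hx⟩, (hj : j = i)⟩⟩
            replace hj := hj.symm
            subst hj
            exact ⟨rfl, ⟨x⟩⟩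
          · rintro ⟨hj, ⟨x⟩⟩
            replace hj := hj.symm
            subst hj
            exact ⟨⟨⟨x, Finset.mem_coe.2 (Finset.mem_insert_self _ _)⟩, rfl⟩⟩
        refine cls_eq (equivalent_of_pieces
          { toFun := fun j => ⟨(), ((hne j.1).1 j.2).2⟩
            invFun := fun u => ⟨i, (hne i).2 ⟨rfl, u.2⟩⟩
            left_inv := fun j => Subtype.ext ((hne j.1).1 j.2).1.symm
            right_inv := fun u => rfl } ?_)
        rintro ⟨j, hj⟩
        have hij := ((hne j).1 hj).1.symm
        subst hij
        refine (Isomorphic.sub_univ _ _ _ (hYi i) fun x => ?_).trans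
          (Isomorphic.sub_univ _ _ _ (hinv (insert i s : Finset I) i) fun x => ?_)
        · rfl
        · exact Finset.mem_coe.2 (Finset.mem_insert_self _ _)
      · refine cls_eq (equivalent_of_pieces' (Equiv.refl _) fun j => ?_)
        refine Isomorphic.sub_sub _ _ _ (hinv (insert i s : Finset I) j) _ _ (hYi.compl j) _ _
          (hinv s j) fun x => ?_
        change j ∈ (s : Set I) ↔ ∃ _ : j ∈ ((insert i s : Finset I) : Set I), ¬ j = i
        constructor
        · exact fun hj => ⟨Finset.mem_coe.2 (Finset.mem_insert_of_mem hj), fun h => hi (h ▸ hj)⟩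
        · rintro ⟨hj, hji⟩
          exact (Finset.mem_insert.1 (Finset.mem_coe.1 hj)).resolve_left hji
  have := key Finset.univ
  rw [← this]
  refine cls_eq (equivalent_of_pieces' (Equiv.refl _) fun i => Isomorphic.symm ?_)
  exact Isomorphic.sub_univ _ _ _ (hinv (Finset.univ : Finset I) i) fun x =>
    Finset.mem_coe.2 (Finset.mem_univ _)

/-- The class of a variety with a finite groups action is the sum of those of its components. -/
theorem cls_eq_sum (𝒳 : FGVar) [Fintype 𝒳.I] : cls 𝒳 = ∑ i, cls (pure (𝒳.piece i)) := by
  rw [← cls_decomp]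
  exact cls_eq (equivalent_of_pieces' (Equiv.refl _) fun i => Isomorphic.refl _)

theorem prod_comm (𝒳 𝒴 : FGVar) : (𝒳.prod 𝒴).Equivalent (𝒴.prod 𝒳) :=
  equivalent_of_pieces' (Equiv.prodComm _ _) fun _ => Isomorphic.prod_comm _ _

theorem prod_assoc (𝒳 𝒴 𝒵 : FGVar) : ((𝒳.prod 𝒴).prod 𝒵).Equivalent (𝒳.prod (𝒴.prod 𝒵)) :=
  equivalent_of_pieces' (Equiv.prodAssoc _ _ _) fun _ => Isomorphic.prod_assoc _ _ _

theorem point_prod (𝒳 : FGVar) : ((pure GVar.point).prod 𝒳).Equivalent 𝒳 :=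
  equivalent_of_pieces' (Equiv.uniqueProd _ _) fun _ => Isomorphic.point_prod _

theorem Equivalent.prod_left (𝒳 : FGVar) {𝒴 𝒴' : FGVar} (h : 𝒴.Equivalent 𝒴') :
    (𝒳.prod 𝒴).Equivalent (𝒳.prod 𝒴') := by
  obtain ⟨P, Q, e, he⟩ := h
  let R : ∀ {𝒵 : FGVar} (_ : 𝒵.Partition), (𝒳.prod 𝒵).Partition := fun {𝒵} P =>
    { K := fun i => P.K i.2
      fin := fun i => P.fin i.2
      label := fun i x => P.label i.2 x.2
      lc := fun i k => (isMor_snd (𝒳.piece i.1).X (𝒵.piece i.2).X).lc_preimage (P.lc i.2 k)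
      inv := fun i k g x hx => P.inv i.2 k g.2 x.2 hx }
  let E : ∀ {𝒵 : FGVar} (P : 𝒵.Partition), (Σ i, (R P).K i) ≃ 𝒳.I × (Σ j, P.K j) := fun P =>
    { toFun := fun k => (k.1.1, ⟨k.1.2, k.2⟩)
      invFun := fun k => ⟨(k.1, k.2.1), k.2.2⟩
      left_inv := fun _ => rfl
      right_inv := fun _ => rfl }
  refine ⟨R P, R Q, ((E P).trans ((Equiv.refl _).prodCongr e)).trans (E Q).symm, ?_⟩
  rintro ⟨⟨i, j⟩, k⟩
  refine (Isomorphic.prod_sub _ _ _ (P.lc j k) (P.inv j k) _ _ _ fun x => Iff.rfl).trans ?_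
  refine ((Isomorphic.refl (𝒳.piece i)).prod (he ⟨j, k⟩)).trans (Isomorphic.symm ?_)
  exact Isomorphic.prod_sub _ _ _ (Q.lc _ _) (Q.inv _ _) _ _ _ fun x => Iff.rfl

end FGVar

theorem cls_prod_relator (𝒳 : FGVar) {r : FreeAbelianGroup FGVar} (hr : Relator r) :
    FreeAbelianGroup.lift (fun 𝒴 => cls (𝒳.prod 𝒴)) r = 0 := by
  cases hr with
  | equivalent 𝒴 𝒴' h =>
    rw [map_sub, FreeAbelianGroup.lift_apply_of, FreeAbelianGroup.lift_apply_of, sub_eq_zero]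
    exact cls_eq (h.prod_left 𝒳)
  | closed 𝒴 Y hY hi =>
    rw [map_sub, map_add, FreeAbelianGroup.lift_apply_of, FreeAbelianGroup.lift_apply_of,
      FreeAbelianGroup.lift_apply_of, sub_eq_zero]
    have hc : IsClosed[(𝒳.prod 𝒴).ambient.top] (Prod.snd ⁻¹' Y) := by
      let := (𝒳.prod 𝒴).ambient.top
      let := 𝒴.ambient.top
      exact hY.preimage (isMor_snd 𝒳.ambient 𝒴.ambient).continuous
    have hi' : (𝒳.prod 𝒴).Inv (Prod.snd ⁻¹' Y) := fun i g x hx => hi i.2 g.2 x.2 hx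
    rw [cls_closed _ _ hc hi']
    congr 1
    · refine cls_eq (FGVar.equivalent_of_pieces' (Equiv.refl _) fun i => ?_)
      exact Isomorphic.prod_sub _ _ _ _ (hi i.2) _ _ (hi' i) fun x => Iff.rfl
    · refine cls_eq (FGVar.equivalent_of_pieces' (Equiv.refl _) fun i => ?_)
      exact Isomorphic.prod_sub _ _ _ _ (hi.compl i.2) _ _ (hi'.compl i) fun x => Iff.rfl
  | ind φ hφ Z =>
    rw [map_sub, FreeAbelianGroup.lift_apply_of, FreeAbelianGroup.lift_apply_of, sub_eq_zero]
    have := Fintype.ofFinite 𝒳.I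
    rw [FGVar.cls_eq_sum (𝒳.prod _), FGVar.cls_eq_sum (𝒳.prod _)]
    refine Finset.sum_congr rfl fun i _ => ?_
    rw [← cls_ind ((MonoidHom.id (𝒳.G i.1)).prodMap φ) (Isomorphic.prodInd_injective hφ)]
    refine cls_eq (FGVar.equivalent_of_pieces' (Equiv.refl _) fun _ => ?_)
    exact Isomorphic.prod_ind _ _ _ hφ

/-- Multiplication by the class of a variety with a finite groups action. -/
noncomputable def mulCls (𝒳 : FGVar) : K0 →+ K0 :=
  QuotientAddGroup.lift _ (FreeAbelianGroup.lift fun 𝒴 => cls (𝒳.prod 𝒴))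
    ((AddSubgroup.closure_le _).2 fun _ hr => cls_prod_relator 𝒳 hr)

theorem mulCls_cls (𝒳 𝒴 : FGVar) : mulCls 𝒳 (cls 𝒴) = cls (𝒳.prod 𝒴) :=
  FreeAbelianGroup.lift_apply_of _ _

/-- The multiplication, as a biadditive map. -/
noncomputable def mulHom : K0 →+ K0 →+ K0 :=
  QuotientAddGroup.lift _ (FreeAbelianGroup.lift mulCls) ((AddSubgroup.closure_le _).2
    fun r hr => by
      change FreeAbelianGroup.lift mulCls r = 0
      ext a
      induction a using K0.induction with
      | h0 => simp
      | hn a ha => rw [map_neg, ha]; simp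
      | ha a b ha hb => rw [map_add, ha, hb]; simp
      | hc 𝒴 =>
        have h : ∀ s, FreeAbelianGroup.lift mulCls s (cls 𝒴) =
            FreeAbelianGroup.lift (fun 𝒳 => cls (𝒴.prod 𝒳)) s := by
          intro s
          induction s using FreeAbelianGroup.induction_on with
          | zero => simp
          | of 𝒳 =>
            rw [FreeAbelianGroup.lift_apply_of, FreeAbelianGroup.lift_apply_of, mulCls_cls]
            exact cls_eq (FGVar.prod_comm _ _)
          | neg 𝒳 h => rw [map_neg, map_neg, AddMonoidHom.neg_apply, h]
          | add x y hx hy => rw [map_add, map_add, AddMonoidHom.add_apply, hx, hy]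
        rw [h, cls_prod_relator 𝒴 hr]
        rfl)

theorem mulHom_cls (𝒳 𝒴 : FGVar) : mulHom (cls 𝒳) (cls 𝒴) = cls (𝒳.prod 𝒴) :=
  (congrArg (fun f : K0 →+ K0 => f (cls 𝒴)) (FreeAbelianGroup.lift_apply_of mulCls 𝒳)).trans
    (mulCls_cls 𝒳 𝒴)

/-- The ring structure: the product of classes is the class of the Cartesian product. -/
noncomputable instance : CommRing K0 :=
  { (inferInstance : AddCommGroup K0) with
    mul := fun a b => mulHom a b
    one := cls (FGVar.pure GVar.point)
    left_distrib := fun a b c => map_add (mulHom a) b c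
    right_distrib := fun a b c => by
      change mulHom (a + b) c = mulHom a c + mulHom b c
      rw [map_add]
      rfl
    zero_mul := fun a => by
      change mulHom 0 a = 0
      rw [map_zero]
      rfl
    mul_zero := fun a => map_zero (mulHom a)
    mul_assoc := fun a b c => by
      change mulHom (mulHom a b) c = mulHom a (mulHom b c)
      induction a using K0.induction with
      | h0 => simp
      | hn a ha => simp [ha]
      | ha a a' h h' => simp [h, h']
      | hc 𝒳 =>
        induction b using K0.induction with
        | h0 => simp
        | hn b hb => simp [hb]
        | ha b b' h h' => simp [h, h']
        | hc 𝒴 =>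
          induction c using K0.induction with
          | h0 => simp
          | hn c hc => simp [hc]
          | ha c c' h h' => simp [h, h']
          | hc 𝒵 =>
            simp only [mulHom_cls]
            exact cls_eq (FGVar.prod_assoc _ _ _)
    one_mul := fun a => by
      change mulHom (cls (FGVar.pure GVar.point)) a = a
      induction a using K0.induction with
      | h0 => simp
      | hn a ha => simp [ha]
      | ha a a' h h' => simp [h, h']
      | hc 𝒳 =>
        rw [mulHom_cls]
        exact cls_eq (FGVar.point_prod _)
    mul_one := fun a => by
      change mulHom a (cls (FGVar.pure GVar.point)) = a
      induction a using K0.induction with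
      | h0 => simp
      | hn a ha => simp [ha]
      | ha a a' h h' => simp [h, h']
      | hc 𝒳 =>
        rw [mulHom_cls, cls_eq (FGVar.prod_comm _ _)]
        exact cls_eq (FGVar.point_prod _)
    mul_comm := fun a b => by
      change mulHom a b = mulHom b a
      induction a using K0.induction with
      | h0 => simp
      | hn a ha => simp [ha]
      | ha a a' h h' => simp [h, h']
      | hc 𝒳 =>
        induction b using K0.induction with
        | h0 => simp
        | hn b hb => simp [hb]
        | ha b b' h h' => simp [h, h']
        | hc 𝒴 =>
          rw [mulHom_cls, mulHom_cls]
          exact cls_eq (FGVar.prod_comm _ _) }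

theorem cls_mul (𝒳 𝒴 : FGVar) : cls 𝒳 * cls 𝒴 = cls (𝒳.prod 𝒴) := mulHom_cls 𝒳 𝒴

/-! ### The series `λ` -/

/-- The wreath product `G_n = G^n ⋊ S_n`, where a permutation `σ` sends `(g_i)` to
`(g_{σ⁻¹ i})`. -/
abbrev Wreath (G : Type) [Group G] (n : ℕ) : Type :=
  (Fin n → G) ⋊[mulAutArrow] Equiv.Perm (Fin n)

instance (G : Type) [Group G] [Finite G] (n : ℕ) : Finite (Wreath G n) :=
  Finite.of_equiv _ SemidirectProduct.equivProd.symm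

namespace GVar

variable {G : Type} [Group G]

/-- The Cartesian power `Z^n` with the action of the wreath product: `G^n` acts componentwise and
`S_n` permutes the components. -/
@[reducible] noncomputable def pow (Z : GVar G) (n : ℕ) : GVar (Wreath G n) :=
  ofMaps (QPVar.pi fun _ : Fin n => Z.X)
    (fun w x i => Z.act (w.left i) (x (w.right⁻¹ i)))
    (fun x => funext fun i => Z.act_one (x i))
    (fun v w _ => funext fun i => Z.act_mul (v.left i) (w.left (v.right⁻¹ i)) _)
    (fun w => isMor_pi _ fun i => (Z.mor (w.left i)).comp (isMor_apply _ (w.right⁻¹ i)))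

/-- The big `G`-diagonal: the `n`-tuples with at least two entries (at different places) in the same
`G`-orbit. -/
def bigDiag (Z : GVar G) (n : ℕ) : Set (Fin n → Z.X.carrier) :=
  {x | ∃ i j, i ≠ j ∧ ∃ g, Z.act g (x i) = x j}

theorem isClosed_bigDiag [Finite G] (Z : GVar G) (n : ℕ) :
    IsClosed[(Z.pow n).X.top] (Z.bigDiag n) := by
  let := (Z.pow n).X.top
  have : Z.bigDiag n = ⋃ p : {p : (Fin n × Fin n) × G // p.1.1 ≠ p.1.2},
      {x | Z.act p.1.2 (x p.1.1.1) = x p.1.1.2} := by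
    ext x
    simp only [bigDiag, Set.mem_iUnion, Set.mem_ofPred_eq]
    constructor
    · rintro ⟨i, j, hij, g, h⟩
      exact ⟨⟨((i, j), g), hij⟩, h⟩
    · rintro ⟨⟨⟨⟨i, j⟩, g⟩, hij⟩, h⟩
      exact ⟨i, j, hij, g, h⟩
  rw [this]
  exact isClosed_iUnion_of_finite fun p => isClosed_eq_locus
    ((Z.mor p.1.2).comp (isMor_apply (fun _ : Fin n => Z.X) p.1.1.1))
    (isMor_apply (fun _ : Fin n => Z.X) p.1.1.2)

theorem inv_compl_bigDiag (Z : GVar G) (n : ℕ) : (Z.pow n).Inv (Z.bigDiag n)ᶜ := by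
  rintro w x hx ⟨i, j, hij, g, h⟩
  refine hx ⟨w.right⁻¹ i, w.right⁻¹ j, w.right⁻¹.injective.ne hij,
    (w.left j)⁻¹ * g * w.left i, ?_⟩
  change Z.act g (Z.act (w.left i) (x (w.right⁻¹ i))) = Z.act (w.left j) (x (w.right⁻¹ j)) at h
  rw [act_mul, act_mul, h, ← act_mul, inv_mul_cancel, act_one]

/-- The complement `Z^n ∖ Δ_G` of the big `G`-diagonal with the action of the wreath product. -/
@[reducible] noncomputable def conf [Finite G] (Z : GVar G) (n : ℕ) : GVar (Wreath G n) :=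
  (Z.pow n).sub (Z.bigDiag n)ᶜ (QPVar.isLC_compl (Z.isClosed_bigDiag n)) (Z.inv_compl_bigDiag n)

/-- The series `λ_{(Z,G)}(t) = 1 + ∑_{n ≥ 1} [(Z^n ∖ Δ_G, G_n)] t^n`. -/
noncomputable def lambdaSeries [Finite G] (Z : GVar G) : PowerSeries K0 :=
  PowerSeries.mk fun n => if n = 0 then 1 else cls (FGVar.pure (Z.conf n))

end GVar

/-- A `λ`-structure on a commutative ring `R`: an additive-to-multiplicative map `a ↦ λ_a(t)` from
`R` to `1 + t R[[t]]` with `λ_a(t) = 1 + a t + …`. -/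
structure IsLambdaStructure {R : Type 1} [CommRing R] (L : R → PowerSeries R) : Prop where
  coeff_zero : ∀ a, PowerSeries.coeff 0 (L a) = 1
  coeff_one : ∀ a, PowerSeries.coeff 1 (L a) = a
  add : ∀ a b, L (a + b) = L a * L b

end FGr

/-! Everything rests on one notion: an `H`-variety `V` is induced from a `G`-variety `Z` if `Z` sits
in `V` as an open subset whose translates by the cosets of `G` partition `V`. Then `V` is isomorphic
to `ind_G^H Z`, so relation (3) gives the two pairs the same class (`IsInduced.cls_eq`).

For (ii), this notion passes to configurations (`IsInduced.conf`): a tuple of points of `V` is moved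
into `Z` entry by entry by an element of `H^n`, and two points of `Z` lie in one `H`-orbit only if
they lie in one `G`-orbit. Hence the series agree coefficient by coefficient.

For (i), let `Y` be a closed invariant subset of `Z`. The configurations of `n` points of `Z` are
stratified by the number `k` of entries in `Y`. Points of `Y` and points outside `Y` never share an
orbit, so the `k`-th stratum is induced, along `G_k × G_{n-k} ⊂ G_n`, from configurations of `k`
points of `Y` times configurations of `n - k` points of the complement (`isInduced_conf_prod`).
Summing over `k` gives the Cauchy product (`lambdaSeries_closed`). Finite partitions into locally
closed invariant parts reduce to this case by cutting along the closures and the boundaries of the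
parts (`prod_of_closed_mul`, `lambdaSeries_partition`); an external disjoint union is a partition
into two parts.

For (iii), the product of the series of the components respects all three defining relations, so it
descends to a homomorphism from the Grothendieck ring to the units of the power series ring
(`lambdaHom`). Classes of pure actions generate the additive group, so the values on them determine
a λ-structure, and the normalisation of the coefficients in degrees 0 and 1 has to be checked on
these generators only. -/

namespace FGr

open scoped Topology

/-! ### Local criterion for morphisms and maps to configuration spaces -/

/-- A map is a morphism if its restrictions to the members of an open cover are morphisms. -/
theorem IsMor.of_open_cover {X Y : QPVar} {f : X.carrier → Y.carrier}
    (h : ∀ x, ∃ (U : Set X.carrier) (hU : IsOpen[X.top] U), x ∈ U ∧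
      IsMor (X.sub U (QPVar.isLC_of_isOpen hU)) Y (fun y => f y.1)) : IsMor X Y f := fun x => by
  obtain ⟨U, hU, hx, h⟩ := h x
  obtain ⟨V, hV, hxV, d, F, hF, h⟩ := h ⟨x, hx⟩
  -- `U` inherits the coordinates of `X`, so its open subsets are traces of open sets `V'` of the
  -- same projective space, and the same polynomials serve on `X`.
  obtain ⟨V', hV', rfl⟩ := isOpen_induced_iff.1 hV
  let := X.top
  refine ⟨U ∩ X.pt ⁻¹' V', hU.inter (hV'.preimage X.continuous_pt), ⟨hx, hxV⟩, d, F, hF,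
    fun y hy => ?_⟩
  exact h ⟨y, hy.1⟩ hy.2

theorem isMor_conf_apply {G : Type} [Group G] [Finite G] (Z : GVar G) (n : ℕ) (i : Fin n) :
    IsMor (Z.conf n).X Z.X (fun x => x.1 i) :=
  (isMor_apply (fun _ : Fin n => Z.X) i).comp
    (isMor_val (Z.pow n).X _ (QPVar.isLC_compl (Z.isClosed_bigDiag n)))

theorem isMor_conf {G : Type} [Group G] [Finite G] {Z : GVar G} {n : ℕ} {W : QPVar}
    {f : W.carrier → (Z.conf n).X.carrier} (hf : ∀ i, IsMor W Z.X (fun w => (f w).1 i)) :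
    IsMor W (Z.conf n).X f :=
  isMor_codRestrict (QPVar.isLC_compl (Z.isClosed_bigDiag n)) (isMor_pi _ hf)

/-! ### Intrinsic characterisation of induced varieties -/

/-- The `H`-variety `V` is induced from the `G`-variety `Z`: there is an equivariant open immersion
of `Z` into `V` such that the translates of `Z` by the cosets of `G` in `H` form a partition of
`V`. -/
def IsInduced {G H : Type} [Group G] [Group H] (Z : GVar G) (V : GVar H) : Prop :=
  ∃ (φ : G →* H) (j : Z.X.carrier → V.X.carrier) (S : Set V.X.carrier)
    (hS : IsOpen[V.X.top] S) (r : S → Z.X.carrier),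
    Function.Injective φ ∧ IsMor Z.X V.X j ∧ IsMor (V.X.sub S (QPVar.isLC_of_isOpen hS)) Z.X r ∧
    (∀ x, j x ∈ S) ∧ (∀ x h, r ⟨j x, h⟩ = x) ∧ (∀ s, j (r s) = s.1) ∧
    (∀ g x, j (Z.act g x) = V.act (φ g) (j x)) ∧
    (∀ v, ∃ h x, V.act h (j x) = v) ∧
    ∀ h x y, V.act h (j x) = j y → ∃ g, φ g = h

namespace IsInduced

variable {G H : Type} [Group G] [Group H] {Z : GVar G} {V : GVar H}

/-- The isomorphism sends the class of `(h, x)` to `h · j x`. Equivariance of `j` makes it well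
defined, the covering condition makes it surjective, the separation condition makes it injective.
The inverse is regular because on the open translate of `S` by `h` it is `v ↦ [(h, r (h⁻¹ v))]`, and
these translates cover `V`. -/
theorem isomorphic_ind [Finite H] (h : IsInduced Z V) :
    ∃ (φ : G →* H) (hφ : Function.Injective φ), Isomorphic (Z.ind φ hφ) V := by
  obtain ⟨φ, j, S, hS, r, hφ, hj, hr, hjS, hrj, hjr, hact, hcov, hsep⟩ := h
  have hinj : Function.Injective j := fun x y hxy => by
    rw [← hrj x (hjS x), ← hrj y (hjS y)]
    congr 1
    exact Subtype.ext hxy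
  refine ⟨φ, hφ, ?_⟩
  obtain ⟨F, hF⟩ : ∃ F : Z.IndCarrier φ → V.X.carrier,
      ∀ h x, F (Z.indMk φ h x) = V.act h (j x) := by
    refine ⟨fun q => Quotient.liftOn (s := Z.indRel φ) q (fun p => V.act p.1 (j p.2)) ?_,
      fun _ _ => rfl⟩
    rintro ⟨h, x⟩ ⟨k, y⟩ ⟨g, h1, h2⟩
    change k = h * (φ g)⁻¹ at h1
    change y = Z.act g x at h2
    change V.act h (j x) = V.act k (j y)
    rw [h1, h2, hact, ← V.act_mul, inv_mul_cancel_right]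
  have hFi : Function.Injective F := by
    intro p q hpq
    induction p using Quotient.inductionOn with
    | h p =>
    induction q using Quotient.inductionOn with
    | h q =>
    obtain ⟨h, x⟩ := p
    obtain ⟨k, y⟩ := q
    replace hpq : V.act h (j x) = V.act k (j y) :=
      (hF h x).symm.trans (hpq.trans (hF k y))
    have h1 : V.act (k⁻¹ * h) (j x) = j y := by
      rw [V.act_mul, hpq, ← V.act_mul, inv_mul_cancel, V.act_one]
    obtain ⟨g, hg⟩ := hsep _ _ _ h1
    refine (Z.indMk_eq_iff φ _ _ _ _).2 ⟨g, ?_, hinj ?_⟩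
    · rw [hg]
      group
    · rw [hact, hg, h1]
  have hFs : Function.Surjective F := fun v => by
    obtain ⟨h, x, hv⟩ := hcov v
    exact ⟨Z.indMk φ h x, (hF h x).trans hv⟩
  have hFm : IsMor (Z.indVar φ hφ) V.X F := by
    refine Z.isMor_ind φ hφ fun h => ?_
    exact ((V.mor h).comp hj).congr fun x => (hF h x).symm
  let e := Equiv.ofBijective F ⟨hFi, hFs⟩
  have hRm : IsMor V.X (Z.indVar φ hφ) e.symm := by
    refine IsMor.of_open_cover fun v => ?_
    obtain ⟨h, x, hv⟩ := hcov v
    have hU : IsOpen[V.X.top] (V.act h⁻¹ ⁻¹' S) := by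
      let := V.X.top
      exact hS.preimage (V.mor h⁻¹).continuous
    refine ⟨V.act h⁻¹ ⁻¹' S, hU, ?_, ?_⟩
    · rw [Set.mem_preimage, ← hv, ← V.act_mul, inv_mul_cancel, V.act_one]
      exact hjS x
    · have hm : IsMor (V.X.sub _ (QPVar.isLC_of_isOpen hU))
          (V.X.sub S (QPVar.isLC_of_isOpen hS)) (fun w => ⟨V.act h⁻¹ w.1, w.2⟩) :=
        isMor_codRestrict _ ((V.mor h⁻¹).comp (isMor_val _ _ _))
      refine ((Z.isMor_indMk φ hφ h).comp (hr.comp hm)).congr fun w => ?_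
      refine (Equiv.eq_symm_apply e).2 ((hF _ _).trans ?_)
      change V.act h (j (r _)) = _
      rw [hjr, ← V.act_mul, mul_inv_cancel, V.act_one]
  refine ⟨MulEquiv.refl H, e, hFm, hRm, fun h q => ?_⟩
  induction q using Quotient.inductionOn with
  | h q =>
    obtain ⟨k, x⟩ := q
    exact (hF (h * k) x).trans ((V.act_mul h k (j x)).trans (congrArg _ (hF k x).symm))

theorem cls_eq [Finite G] [Finite H] (h : IsInduced Z V) :
    cls (FGVar.pure Z) = cls (FGVar.pure V) := by
  obtain ⟨φ, hφ, h⟩ := h.isomorphic_ind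
  rw [← cls_ind φ hφ]
  exact FGr.cls_eq (FGVar.equivalent_of_pieces' (Equiv.refl _) fun _ => h)

/-- The degenerate case with a single coset, where `S` is all of `V`. Invariance of the series under
isomorphism thus needs no separate argument. -/
theorem of_isomorphic (h : Isomorphic Z V) : IsInduced Z V := by
  obtain ⟨φ, ψ, h1, h2, h3⟩ := h
  refine ⟨φ, ψ, Set.univ, @isOpen_univ _ V.X.top, fun v => ψ.symm v.1, φ.injective, h1,
    h2.comp (isMor_val _ _ _), fun _ => trivial, fun x _ => ψ.symm_apply_apply x,
    fun s => ψ.apply_symm_apply s.1, h3, fun v => ⟨1, ψ.symm v, ?_⟩,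
    fun h _ _ _ => ⟨φ.symm h, φ.apply_symm_apply h⟩⟩
  rw [V.act_one, ψ.apply_symm_apply]

/-- The embedded copy of `Z` is `x ↦ [(1, x)]`; its image is the summand indexed by the coset of
`1`, hence open. The representative `c.out` of that coset need not be `1`, so the summand coordinate
differs from `x` by an element of `G`. -/
theorem of_ind [Finite H] (Z : GVar G) (φ : G →* H) (hφ : Function.Injective φ) :
    IsInduced Z (Z.ind φ hφ) := by
  let c : H ⧸ φ.range := QuotientGroup.mk 1
  have hj := Z.isMor_indMk φ hφ 1
  have hmem : ∀ x, (Z.indEquiv φ hφ (Z.indMk φ 1 x)).1 = c := by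
    intro x
    obtain ⟨⟨d, y⟩, h⟩ : ∃ p, Z.indEquiv φ hφ (Z.indMk φ 1 x) = p := ⟨_, rfl⟩
    rw [h]
    rw [← Equiv.eq_symm_apply, Z.indEquiv_symm, Z.indMk_eq_iff] at h
    obtain ⟨g, h1, -⟩ := h
    rw [← QuotientGroup.out_eq' d]
    refine QuotientGroup.eq.2 ?_
    rw [h1]
    simp
  have hmem' : ∀ v : Z.IndCarrier φ, (Z.indEquiv φ hφ v).1 = c → ∃ x, v = Z.indMk φ 1 x := by
    intro v hv
    obtain ⟨⟨d, y⟩, h⟩ : ∃ p, Z.indEquiv φ hφ v = p := ⟨_, rfl⟩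
    rw [h] at hv
    obtain rfl : d = c := hv
    rw [← Equiv.eq_symm_apply, Z.indEquiv_symm] at h
    have : (c.out)⁻¹ * 1 ∈ φ.range := by
      rw [← QuotientGroup.eq, QuotientGroup.out_eq']
    obtain ⟨g, hg⟩ := this
    refine ⟨Z.act g⁻¹ y, h.trans ((Z.indMk_eq_iff φ _ _ _ _).2 ⟨g⁻¹, ?_, rfl⟩)⟩
    rw [map_inv, hg]
    group
  have hinj : Function.Injective (Z.indMk φ 1) := by
    intro x y h
    obtain ⟨g, h1, h2⟩ := (Z.indMk_eq_iff φ _ _ _ _).1 h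
    have hg : g = 1 := hφ (by simpa using h1)
    subst hg
    simpa using h2.symm
  let S : Set (Z.IndCarrier φ) := {v | (Z.indEquiv φ hφ v).1 = c}
  have hS : IsOpen[(Z.indVar φ hφ).top] S := by
    exact @Continuous.isOpen_preimage _ _ (_) (_) _
      (isMor_transport _ (Z.indEquiv φ hφ)).continuous _
      (Isomorphic.isOpen_component (fun _ : H ⧸ φ.range => Z.X) c)
  choose r hr using fun s : S => hmem' s.1 s.2
  refine ⟨φ, Z.indMk φ 1, S, hS, r, hφ, hj, ?_, hmem, fun x h => hinj (hr ⟨_, h⟩).symm,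
    fun s => (hr s).symm, fun g x => ?_, fun v => ?_, fun h x y hxy => ?_⟩
  -- The map `r` was chosen pointwise. It is regular because it agrees with the explicit map that
  -- takes the summand coordinate `y` to `g⁻¹ y`, where `φ g = c.out⁻¹`.
  · have hc : c.out⁻¹ * 1 ∈ φ.range := by
      rw [← QuotientGroup.eq, QuotientGroup.out_eq']
    obtain ⟨g, hg⟩ := hc
    have hv' : ∀ v : Z.IndCarrier φ, (Z.indEquiv φ hφ v).1 = c →
        Z.indMk φ 1 (Z.act g⁻¹ (Z.indEquiv φ hφ v).2) = v := by
      intro v hv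
      obtain ⟨⟨d, y⟩, h⟩ : ∃ p, Z.indEquiv φ hφ v = p := ⟨_, rfl⟩
      rw [h] at hv ⊢
      obtain rfl : d = c := hv
      rw [← Equiv.eq_symm_apply, Z.indEquiv_symm] at h
      rw [h]
      refine ((Z.indMk_eq_iff φ _ _ _ _).2 ⟨g⁻¹, ?_, rfl⟩).symm
      rw [map_inv, hg]
      group
    have hsnd : IsMor (QPVar.sigma (fun _ : H ⧸ φ.range => Z.X)) Z.X (fun p => Z.act g⁻¹ p.2) :=
      isMor_sigma _ fun _ => Z.mor g⁻¹
    refine ((hsnd.comp (isMor_transport _ (Z.indEquiv φ hφ))).comp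
      (isMor_val (Z.indVar φ hφ) S (QPVar.isLC_of_isOpen hS))).congr fun s => hinj ?_
    rw [← hr s]
    exact hv' s.1 s.2
  · refine Eq.trans ?_ (Z.indAct_mk φ (φ g) 1 x).symm
    exact ((Z.indMk_eq_iff φ _ _ _ _).2 ⟨g, by simp, rfl⟩).symm
  · induction v using Quotient.inductionOn with
    | h p =>
      refine ⟨p.1, p.2, (Z.indAct_mk φ p.1 1 p.2).trans ?_⟩
      rw [mul_one]
      rfl
  · have hxy := (Z.indAct_mk φ h 1 x).symm.trans hxy
    obtain ⟨g, h1, -⟩ := (Z.indMk_eq_iff φ _ _ _ _).1 hxy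
    refine ⟨g, ?_⟩
    rw [mul_one, eq_comm, mul_inv_eq_one] at h1
    exact h1.symm

/-- The homomorphism of wreath products given by a homomorphism of the groups. -/
def wreathMap (φ : G →* H) (n : ℕ) : Wreath G n →* Wreath H n where
  toFun w := ⟨fun i => φ (w.left i), w.right⟩
  map_one' := SemidirectProduct.ext (funext fun _ => map_one φ) rfl
  map_mul' _ _ := SemidirectProduct.ext (funext fun _ => map_mul φ _ _) rfl

theorem wreathMap_injective {φ : G →* H} (hφ : Function.Injective φ) (n : ℕ) :
    Function.Injective (wreathMap φ n) := fun _ _ h =>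
  SemidirectProduct.ext
    (funext fun i => hφ (congrFun (congrArg (fun w : Wreath H n => w.left) h) i))
    (congrArg (fun w : Wreath H n => w.right) h)

/-- The open copy consists of the configurations with all entries in the copy of `Z`. Each of the
three conditions (diagonal, covering, separation) reduces to the corresponding fact for single
entries. -/
theorem conf [Finite G] [Finite H] (h : IsInduced Z V) (n : ℕ) :
    IsInduced (Z.conf n) (V.conf n) := by
  obtain ⟨φ, j, S, hS, r, hφ, hj, hr, hjS, hrj, hjr, hact, hcov, hsep⟩ := h
  have hinj : Function.Injective j := fun x y hxy => by
    rw [← hrj x (hjS x), ← hrj y (hjS y)]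
    congr 1
    exact Subtype.ext hxy
  -- Separation enters here: an element of `H` taking `j (x a)` to `j (x b)` comes from `G`, so
  -- passing to `V` identifies no further orbits.
  have hdiag : ∀ x : Fin n → Z.X.carrier, (fun i => j (x i)) ∈ V.bigDiag n ↔ x ∈ Z.bigDiag n := by
    intro x
    constructor
    · rintro ⟨a, b, hab, h, hx⟩
      obtain ⟨g, rfl⟩ := hsep _ _ _ hx
      exact ⟨a, b, hab, g, hinj ((hact _ _).trans hx)⟩
    · rintro ⟨a, b, hab, g, hx⟩
      exact ⟨a, b, hab, φ g, (hact _ _).symm.trans (congrArg j hx)⟩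
  have hT : IsOpen[(V.conf n).X.top] {x : (V.conf n).X.carrier | ∀ i, x.1 i ∈ S} := by
    let := (V.conf n).X.top
    let := V.X.top
    rw [Set.ofPred_forall]
    exact isOpen_iInter_of_finite fun i => hS.preimage
      (isMor_conf_apply V n i).continuous
  refine ⟨wreathMap φ n, fun x => ⟨fun i => j (x.1 i), fun h => x.2 ((hdiag _).1 h)⟩,
    {x : (V.conf n).X.carrier | ∀ i, x.1 i ∈ S}, hT,
    fun s => ⟨fun i => r ⟨s.1.1 i, s.2 i⟩, fun h => s.1.2 ?_⟩, wreathMap_injective hφ n, ?_, ?_,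
    fun x i => hjS _, fun x h => Subtype.ext (funext fun i => hrj _ _),
    fun s => Subtype.ext (funext fun i => hjr _), ?_, ?_, ?_⟩
  · have := (hdiag _).2 h
    simpa only [hjr] using this
  · exact isMor_conf fun i => hj.comp (isMor_conf_apply Z n i)
  · exact isMor_conf fun i => hr.comp (isMor_codRestrict _
      ((isMor_conf_apply V n i).comp (isMor_val _ _ (QPVar.isLC_of_isOpen hT))))
  · exact fun w x => Subtype.ext (funext fun i => hact _ _)
  · rintro ⟨v, hv⟩
    choose h x hx using fun i => hcov (v i)
    -- Each entry is moved into `Z` by its own element of `H`; no permutation is needed.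
    refine ⟨⟨h, 1⟩, ⟨x, fun hd => hv ?_⟩, Subtype.ext (funext fun i => hx i)⟩
    obtain ⟨a, b, hab, g, hg⟩ := hd
    refine ⟨a, b, hab, h b * φ g * (h a)⁻¹, ?_⟩
    rw [← hx a, ← V.act_mul, inv_mul_cancel_right, V.act_mul, ← hact, hg, hx b]
  · intro w x y hxy
    have hxy : ∀ i, V.act (w.left i) (j (x.1 (w.right⁻¹ i))) = j (y.1 i) := fun i =>
      congrFun (congrArg Subtype.val hxy) i
    choose g hg using fun i => hsep _ _ _ (hxy i)
    exact ⟨⟨g, w.right⟩, SemidirectProduct.ext (funext hg) rfl⟩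

end IsInduced

/-! ### Classes of products and of partitions; coefficients of the series -/

theorem cls_pure_mul {G H : Type} [Group G] [Finite G] [Group H] [Finite H] (Z : GVar G)
    (W : GVar H) :
    cls (FGVar.pure Z) * cls (FGVar.pure W) = cls (FGVar.pure (Z.prod W)) := by
  rw [cls_mul]
  exact cls_eq (FGVar.equivalent_of_pieces' (Equiv.uniqueProd Unit Unit) fun _ =>
    Isomorphic.refl _)

/-- `Z` and the disjoint union of its strata are equivalent, the strata being the parts on both
sides. Additivity for locally closed partitions therefore follows from relation (1) and from
`FGVar.cls_decomp`, without an induction over closed sets. -/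
theorem cls_pure_eq_sum {G : Type} [Group G] [Finite G] (Z : GVar G) {K : Type} [Fintype K]
    (l : Z.X.carrier → K) (hl : ∀ k, Z.X.IsLC {x | l x = k}) (hi : ∀ k, Z.Inv {x | l x = k}) :
    cls (FGVar.pure Z) = ∑ k, cls (FGVar.pure (Z.sub _ (hl k) (hi k))) := by
  rw [← FGVar.cls_decomp]
  let 𝒟 := FGVar.disj (fun _ : K => G) fun k => Z.sub _ (hl k) (hi k)
  let P : (FGVar.pure Z).Partition :=
    { K := fun _ => K
      fin := fun _ => inferInstance
      label := fun _ => l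
      lc := fun _ => hl
      inv := fun _ => hi }
  let Q : 𝒟.Partition :=
    { K := fun _ => Unit
      fin := fun _ => inferInstance
      label := fun _ _ => ()
      lc := fun i _ => by
        convert QPVar.isLC_univ _ using 1
        exact Set.eq_univ_of_forall fun _ => rfl
      inv := fun _ _ _ _ _ => rfl }
  refine cls_eq ⟨P, Q, ⟨fun k => ⟨k.2, ()⟩, fun k => ⟨(), k.1⟩, fun _ => rfl, fun _ => rfl⟩,
    fun k => Isomorphic.symm ?_⟩
  exact Isomorphic.sub_univ (Z.sub _ (hl k.2) (hi k.2)) _ _ _ fun x => rfl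

/-- The separate value `1` at `n = 0` is also the class of the empty configuration: a point acted on
by the trivial group. So later arguments need not single out degree `0`. -/
theorem coeff_lambdaSeries {G : Type} [Group G] [Finite G] (Z : GVar G) (n : ℕ) :
    PowerSeries.coeff n Z.lambdaSeries = cls (FGVar.pure (Z.conf n)) := by
  rw [GVar.lambdaSeries, PowerSeries.coeff_mk]
  split_ifs with h
  · subst h
    refine cls_eq (FGVar.equivalent_of_pieces' (Equiv.refl _) fun _ => ?_)
    refine Isomorphic.of_maps (Z := GVar.point) (W := Z.conf 0)
      { toFun := fun _ => 1
        invFun := fun _ => ()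
        left_inv := fun _ => rfl
        right_inv := fun w => SemidirectProduct.ext (Subsingleton.elim _ _) (Subsingleton.elim _ _)
        map_mul' := fun _ _ => (mul_one _).symm }
      (fun _ => ⟨fun i => i.elim0, ?_⟩) (fun _ => ()) (isMor_conf fun i => i.elim0)
      (Isomorphic.isMor_const _ QPVar.point ()) (fun _ => rfl)
      (fun y => Subtype.ext (Subsingleton.elim _ _))
      (fun _ _ => Subtype.ext (Subsingleton.elim _ _))
    rintro ⟨i, -⟩
    exact i.elim0
  · rfl

/-! ### Block permutations and the embedding of products of wreath products -/

/-- Permutations of two consecutive blocks. -/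
def blockPerm (k m : ℕ) :
    Equiv.Perm (Fin k) × Equiv.Perm (Fin m) →* Equiv.Perm (Fin (k + m)) :=
  (finSumFinEquiv (m := k) (n := m)).permCongrHom.toMonoidHom.comp
    (Equiv.Perm.sumCongrHom (Fin k) (Fin m))

theorem blockPerm_castAdd {k m : ℕ} (p : Equiv.Perm (Fin k) × Equiv.Perm (Fin m)) (i : Fin k) :
    blockPerm k m p (Fin.castAdd m i) = Fin.castAdd m (p.1 i) := by
  simp [blockPerm]

theorem blockPerm_natAdd {k m : ℕ} (p : Equiv.Perm (Fin k) × Equiv.Perm (Fin m)) (i : Fin m) :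
    blockPerm k m p (Fin.natAdd k i) = Fin.natAdd k (p.2 i) := by
  simp [blockPerm]

/-- Both the product in the wreath product and its action on tuples read entries at inverse images
of indices, so the block formulas are needed for inverses. -/
theorem blockPerm_inv_castAdd {k m : ℕ} (p : Equiv.Perm (Fin k) × Equiv.Perm (Fin m))
    (i : Fin k) : (blockPerm k m p)⁻¹ (Fin.castAdd m i) = Fin.castAdd m (p.1⁻¹ i) := by
  rw [← map_inv, blockPerm_castAdd]
  rfl

theorem blockPerm_inv_natAdd {k m : ℕ} (p : Equiv.Perm (Fin k) × Equiv.Perm (Fin m))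
    (i : Fin m) : (blockPerm k m p)⁻¹ (Fin.natAdd k i) = Fin.natAdd k (p.2⁻¹ i) := by
  rw [← map_inv, blockPerm_natAdd]
  rfl

/-- By finiteness, a permutation mapping the first block into itself also preserves the second
block. -/
theorem exists_blockPerm {k m : ℕ} (σ : Equiv.Perm (Fin (k + m)))
    (h : ∀ i : Fin k, ∃ i' : Fin k, σ (Fin.castAdd m i) = Fin.castAdd m i') :
    ∃ p, blockPerm k m p = σ := by
  have h1 : finSumFinEquiv.permCongrHom.symm σ ∈ (Equiv.Perm.sumCongrHom (Fin k) (Fin m)).range := by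
    refine Equiv.Perm.mem_sumCongrHom_range_of_perm_mapsTo_inl ?_
    rintro _ ⟨i, rfl⟩
    obtain ⟨i', hi⟩ := h i
    refine ⟨i', ?_⟩
    simp [Equiv.permCongrHom, hi]
  obtain ⟨p, hp⟩ := h1
  refine ⟨p, ?_⟩
  change finSumFinEquiv.permCongrHom (Equiv.Perm.sumCongrHom _ _ p) = σ
  rw [hp, MulEquiv.apply_symm_apply]

/-- The embedding `G_k × G_m → G_{k+m}`. -/
def wreathAppend (G : Type) [Group G] (k m : ℕ) : Wreath G k × Wreath G m →* Wreath G (k + m) where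
  toFun p := ⟨Fin.append p.1.left p.2.left, blockPerm k m (p.1.right, p.2.right)⟩
  map_one' := by
    refine SemidirectProduct.ext (funext fun i => ?_) (map_one (blockPerm k m))
    refine Fin.addCases (fun i => ?_) (fun i => ?_) i
    · exact Fin.append_left _ _ _
    · exact Fin.append_right _ _ _
  map_mul' v w := by
    refine SemidirectProduct.ext (funext fun i => ?_)
      (map_mul (blockPerm k m) (v.1.right, v.2.right) (w.1.right, w.2.right))
    change Fin.append _ _ i = Fin.append v.1.left v.2.left i *
      Fin.append w.1.left w.2.left ((blockPerm k m (v.1.right, v.2.right))⁻¹ i)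
    refine Fin.addCases (fun i => ?_) (fun i => ?_) i
    · rw [blockPerm_inv_castAdd, Fin.append_left, Fin.append_left, Fin.append_left]
      rfl
    · rw [blockPerm_inv_natAdd, Fin.append_right, Fin.append_right, Fin.append_right]
      rfl

theorem wreathAppend_injective (G : Type) [Group G] (k m : ℕ) :
    Function.Injective (wreathAppend G k m) := by
  rintro ⟨v, w⟩ ⟨v', w'⟩ h
  have h1 : Fin.append v.left w.left = Fin.append v'.left w'.left :=
    congrArg (fun w : Wreath G (k + m) => w.left) h
  have h2 : blockPerm k m (v.right, w.right) = blockPerm k m (v'.right, w'.right) :=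
    congrArg (fun w : Wreath G (k + m) => w.right) h
  refine Prod.ext (SemidirectProduct.ext (funext fun i => ?_) (Equiv.ext fun i => ?_))
    (SemidirectProduct.ext (funext fun i => ?_) (Equiv.ext fun i => ?_))
  · simpa using congrFun h1 (Fin.castAdd m i)
  · simpa [blockPerm_castAdd] using Equiv.congr_fun h2 (Fin.castAdd m i)
  · simpa using congrFun h1 (Fin.natAdd k i)
  · simpa [blockPerm_natAdd] using Equiv.congr_fun h2 (Fin.natAdd k i)

/-! ### Counting the entries of a tuple that lie in a subset -/

open Classical in
/-- The number of the entries of a tuple that belong to `Y`. -/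
noncomputable def entryCount {T : Type} (Y : Set T) {n : ℕ} (x : Fin n → T) : ℕ :=
  (Finset.univ.filter fun i => x i ∈ Y).card

/-- This turns a lower bound on the count into a finite union of finite intersections of conditions
on single entries, the form in which closedness is visible. -/
theorem le_entryCount_iff {T : Type} (Y : Set T) {n : ℕ} (x : Fin n → T) (k : ℕ) :
    k ≤ entryCount Y x ↔ ∃ s : Finset (Fin n), s.card = k ∧ ∀ i ∈ s, x i ∈ Y := by
  classical
  rw [entryCount, Finset.le_card_iff_exists_subset_card]
  constructor
  · rintro ⟨s, hs, hk⟩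
    exact ⟨s, hk, fun i hi => (Finset.mem_filter.1 (hs hi)).2⟩
  · rintro ⟨s, hk, hs⟩
    exact ⟨s, fun i hi => Finset.mem_filter.2 ⟨Finset.mem_univ i, hs i hi⟩, hk⟩

theorem entryCount_le {T : Type} (Y : Set T) {n : ℕ} (x : Fin n → T) : entryCount Y x ≤ n :=
  (Finset.card_le_univ _).trans (Fintype.card_fin n).le

theorem entryCount_append {T : Type} {Y : Set T} {k m : ℕ} {x : Fin k → T} {y : Fin m → T}
    (hx : ∀ i, x i ∈ Y) (hy : ∀ i, y i ∉ Y) : entryCount Y (Fin.append x y) = k := by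
  classical
  rw [entryCount, Finset.card_filter, Fin.sum_univ_add]
  simp [hx, hy]

/-- When the last `m` entries contribute nothing, the `k` entries in `Y` have to fill the whole
first block. This lets an open condition on the last block control the first block too. -/
theorem mem_of_entryCount {T : Type} {Y : Set T} {k m : ℕ} {x : Fin (k + m) → T}
    (hx : entryCount Y x = k) (hy : ∀ i : Fin m, x (Fin.natAdd k i) ∉ Y) (i : Fin k) :
    x (Fin.castAdd m i) ∈ Y := by
  classical
  rw [entryCount, Finset.card_filter, Fin.sum_univ_add] at hx
  simp only [hy, if_false, Finset.sum_const_zero, add_zero] at hx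
  rw [← Finset.card_filter] at hx
  have h : (Finset.univ.filter fun i : Fin k => x (Fin.castAdd m i) ∈ Y) = Finset.univ :=
    (Finset.card_eq_iff_eq_univ _).1 (hx.trans (Fintype.card_fin k).symm)
  simpa using Finset.ext_iff.1 h i

/-- Enumerations of the `k` positions with entries in `Y` and of the `m` remaining positions are
glued into one permutation, which sorts the tuple. -/
theorem exists_perm_of_entryCount {T : Type} {Y : Set T} {k m : ℕ} {x : Fin (k + m) → T}
    (hx : entryCount Y x = k) : ∃ σ : Equiv.Perm (Fin (k + m)),
      (∀ i : Fin k, x (σ (Fin.castAdd m i)) ∈ Y) ∧ ∀ i : Fin m, x (σ (Fin.natAdd k i)) ∉ Y := by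
  classical
  have h1 : Fintype.card (Fin k) = Fintype.card {i // x i ∈ Y} := by
    rw [Fintype.card_fin, Fintype.card_subtype]
    exact hx.symm
  have h2 : Fintype.card (Fin m) = Fintype.card {i // ¬ x i ∈ Y} := by
    rw [Fintype.card_subtype_compl, ← h1]
    simp
  let e := Fintype.equivOfCardEq h1
  let f := Fintype.equivOfCardEq h2
  refine ⟨(finSumFinEquiv.symm.trans (e.sumCongr f)).trans (Equiv.sumCompl fun i => x i ∈ Y),
    fun i => ?_, fun i => ?_⟩
  · simpa using (e i).2
  · simpa using (f i).2

/-! ### Stratification of configurations and the closed case of multiplicativity -/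

section conf

variable {G : Type} [Group G]

theorem GVar.Inv.mem_iff {Z : GVar G} {Y : Set Z.X.carrier} (h : Z.Inv Y) (g : G)
    (x : Z.X.carrier) : Z.act g x ∈ Y ↔ x ∈ Y :=
  ⟨fun hx => by simpa using h g⁻¹ _ hx, h g x⟩

variable [Finite G]

theorem isClosed_le_entryCount (Z : GVar G) {Y : Set Z.X.carrier} (hY : IsClosed[Z.X.top] Y)
    (n k : ℕ) :
    IsClosed[(Z.conf n).X.top] {x : (Z.conf n).X.carrier | k ≤ entryCount Y x.1} := by
  let := (Z.conf n).X.top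
  let := Z.X.top
  have : {x : (Z.conf n).X.carrier | k ≤ entryCount Y x.1} =
      ⋃ s : {s : Finset (Fin n) // s.card = k}, ⋂ i ∈ s.1, {x | x.1 i ∈ Y} := by
    ext x
    simp [le_entryCount_iff]
  rw [this]
  exact isClosed_iUnion_of_finite fun s => isClosed_biInter fun i _ =>
    hY.preimage (isMor_conf_apply Z n i).continuous

/-- "Exactly `k`" is the closed condition "at least `k`" minus the closed condition "at least `k +
1`". -/
theorem isLC_entryCount (Z : GVar G) {Y : Set Z.X.carrier} (hY : IsClosed[Z.X.top] Y) (n k : ℕ) :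
    (Z.conf n).X.IsLC {x : (Z.conf n).X.carrier | entryCount Y x.1 = k} := by
  have : {x : (Z.conf n).X.carrier | entryCount Y x.1 = k} =
      {x : (Z.conf n).X.carrier | k ≤ entryCount Y x.1} ∩
        {x : (Z.conf n).X.carrier | k + 1 ≤ entryCount Y x.1}ᶜ := by
    ext x
    simp only [Set.mem_ofPred_eq, Set.mem_inter_iff, Set.mem_compl_iff]
    omega
  rw [this]
  exact (QPVar.isLC_of_isClosed (isClosed_le_entryCount Z hY n k)).inter
    (QPVar.isLC_compl (isClosed_le_entryCount Z hY n (k + 1)))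

/-- The permutation part of `w` matches the two sets of positions, and the `G^n` part does not
affect membership in the invariant set `Y`. -/
theorem entryCount_act (Z : GVar G) {Y : Set Z.X.carrier} (hi : Z.Inv Y) {n : ℕ} (w : Wreath G n)
    (x : (Z.conf n).X.carrier) : entryCount Y ((Z.conf n).act w x).1 = entryCount Y x.1 := by
  classical
  refine Finset.card_equiv w.right⁻¹ fun i => ?_
  simp only [Finset.mem_filter, Finset.mem_univ, true_and]
  exact hi.mem_iff _ _

theorem inv_entryCount (Z : GVar G) {Y : Set Z.X.carrier} (hi : Z.Inv Y) (n k : ℕ) :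
    (Z.conf n).Inv {x : (Z.conf n).X.carrier | entryCount Y x.1 = k} := fun w x hx =>
  (entryCount_act Z hi w x).trans hx

/-- The configurations of `k + m` points, `k` of which are in `Y`, are induced from the product of
the spaces of configurations of `k` points of `Y` and of `m` points of the complement of `Y`. -/
theorem isInduced_conf_prod (Z : GVar G) {Y : Set Z.X.carrier} (hY : IsClosed[Z.X.top] Y)
    (hi : Z.Inv Y) (k m : ℕ) :
    IsInduced (((Z.sub Y (QPVar.isLC_of_isClosed hY) hi).conf k).prod
      ((Z.sub Yᶜ (QPVar.isLC_compl hY) hi.compl).conf m))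
      ((Z.conf (k + m)).sub _ (isLC_entryCount Z hY (k + m) k) (inv_entryCount Z hi (k + m) k)) := by
  set A := Z.sub Y (QPVar.isLC_of_isClosed hY) hi
  set B := Z.sub Yᶜ (QPVar.isLC_compl hY) hi.compl
  set V := (Z.conf (k + m)).sub _ (isLC_entryCount Z hY (k + m) k) (inv_entryCount Z hi (k + m) k)
  have hVm : ∀ i, IsMor V.X Z.X (fun v => v.1.1 i) := fun i =>
    (isMor_conf_apply Z _ i).comp (isMor_val _ _ (isLC_entryCount Z hY (k + m) k))
  -- On this stratum, keeping the last `m` entries out of `Y` forces the first `k` into `Y`. So an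
  -- open condition cuts out exactly the sorted configurations, the image of the product.
  have hS : IsOpen[V.X.top] {v : V.X.carrier | ∀ i : Fin m, v.1.1 (Fin.natAdd k i) ∈ Yᶜ} := by
    let := V.X.top
    let := Z.X.top
    rw [Set.ofPred_forall]
    exact isOpen_iInter_of_finite fun i => hY.isOpen_compl.preimage (hVm _).continuous
  let J : (Fin k → Y) → (Fin m → (Yᶜ : Set _)) → Fin (k + m) → Z.X.carrier := fun x y =>
    Fin.append (fun i => (x i).1) (fun i => (y i).1)
  have J1 : ∀ x y i, J x y (Fin.castAdd m i) = (x i).1 := fun x y i => Fin.append_left _ _ _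
  have J2 : ∀ x y i, J x y (Fin.natAdd k i) = (y i).1 := fun x y i => Fin.append_right _ _ _
  -- Entries from different blocks cannot share an orbit, since `Y` and its complement are
  -- invariant. Hence the diagonal conditions on the two factors suffice.
  have hJd : ∀ (x : Fin k → Y) (y : Fin m → (Yᶜ : Set _)), x ∉ A.bigDiag k → y ∉ B.bigDiag m →
      J x y ∉ Z.bigDiag (k + m) := by
    rintro x y hx hy ⟨a, b, hab, g, hg⟩
    induction a using Fin.addCases with
    | left a =>
      induction b using Fin.addCases with
      | left b =>
        rw [J1, J1] at hg
        exact hx ⟨a, b, fun h => hab (h ▸ rfl), g, Subtype.ext hg⟩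
      | right b =>
        rw [J1, J2] at hg
        exact (y b).2 (hg ▸ hi g _ (x a).2)
    | right a =>
      induction b using Fin.addCases with
      | left b =>
        rw [J1, J2] at hg
        exact hi.compl g _ (y a).2 (hg ▸ (x b).2)
      | right b =>
        rw [J2, J2] at hg
        exact hy ⟨a, b, fun h => hab (h ▸ rfl), g, Subtype.ext hg⟩
  have hJc : ∀ x y, entryCount Y (J x y) = k := fun x y =>
    entryCount_append (fun i => (x i).2) (fun i => (y i).2)
  have hVY : ∀ (v : V.X.carrier), (∀ i : Fin m, v.1.1 (Fin.natAdd k i) ∈ Yᶜ) →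
      ∀ i, v.1.1 (Fin.castAdd m i) ∈ Y := fun v hv i => mem_of_entryCount v.2 hv i
  refine ⟨wreathAppend G k m, fun p => ⟨⟨J p.1.1 p.2.1, hJd _ _ p.1.2 p.2.2⟩, hJc _ _⟩, _, hS,
    fun s => (⟨fun i => ⟨_, hVY s.1 s.2 i⟩, ?_⟩, ⟨fun i => ⟨_, s.2 i⟩, ?_⟩),
    wreathAppend_injective G k m, ?_, ?_, fun p i => ?_, fun p _ => ?_, fun s => ?_, fun w p => ?_,
    fun v => ?_, fun w p q h => ?_⟩
  · rintro ⟨a, b, hab, g, hg⟩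
    exact s.1.1.2 ⟨_, _, (Fin.castAdd_injective k m).ne hab, g, congrArg Subtype.val hg⟩
  · rintro ⟨a, b, hab, g, hg⟩
    exact s.1.1.2 ⟨_, _, (Fin.natAdd_injective m k).ne hab, g, congrArg Subtype.val hg⟩
  · refine isMor_codRestrict (isLC_entryCount Z hY (k + m) k) (isMor_conf fun i => ?_)
    induction i using Fin.addCases with
    | left i =>
      simp only [J1]
      exact (isMor_val _ _ (QPVar.isLC_of_isClosed hY)).comp
        ((isMor_conf_apply A k i).comp (isMor_fst _ _))
    | right i =>
      simp only [J2]
      exact (isMor_val _ _ (QPVar.isLC_compl hY)).comp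
        ((isMor_conf_apply B m i).comp (isMor_snd _ _))
  · refine isMor_prodMk
      (isMor_conf fun i => isMor_codRestrict (QPVar.isLC_of_isClosed hY) ?_)
      (isMor_conf fun i => isMor_codRestrict (QPVar.isLC_compl hY) ?_)
    · exact (hVm _).comp (isMor_val V.X _ (QPVar.isLC_of_isOpen hS))
    · exact (hVm _).comp (isMor_val V.X _ (QPVar.isLC_of_isOpen hS))
  · change J p.1.1 p.2.1 (Fin.natAdd k i) ∈ Yᶜ
    rw [J2]
    exact (p.2.1 i).2
  · refine Prod.ext (Subtype.ext (funext fun i => Subtype.ext (J1 _ _ _)))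
      (Subtype.ext (funext fun i => Subtype.ext (J2 _ _ _)))
  · refine Subtype.ext (Subtype.ext (funext fun i => ?_))
    induction i using Fin.addCases with
    | left i => exact J1 _ _ _
    | right i => exact J2 _ _ _
  · refine Subtype.ext (Subtype.ext (funext fun i => ?_))
    change J _ _ i = Z.act (Fin.append w.1.left w.2.left i)
      (J p.1.1 p.2.1 ((blockPerm k m (w.1.right, w.2.right))⁻¹ i))
    induction i using Fin.addCases with
    | left i =>
      rw [blockPerm_inv_castAdd, J1, J1, Fin.append_left]
      rfl
    | right i =>
      rw [blockPerm_inv_natAdd, J2, J2, Fin.append_right]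
      rfl
  -- Covering: a pure permutation takes the sorted tuple back to `v`.
  · obtain ⟨σ, h1, h2⟩ := exists_perm_of_entryCount v.2
    refine ⟨⟨1, σ⟩, (⟨fun i => ⟨_, h1 i⟩, ?_⟩, ⟨fun i => ⟨_, h2 i⟩, ?_⟩), ?_⟩
    · rintro ⟨a, b, hab, g, hg⟩
      exact v.1.2 ⟨_, _, σ.injective.ne ((Fin.castAdd_injective k m).ne hab), g,
        congrArg Subtype.val hg⟩
    · rintro ⟨a, b, hab, g, hg⟩
      exact v.1.2 ⟨_, _, σ.injective.ne ((Fin.natAdd_injective m k).ne hab), g,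
        congrArg Subtype.val hg⟩
    · refine Subtype.ext (Subtype.ext (funext fun i => ?_))
      change Z.act 1 (J _ _ (σ⁻¹ i)) = v.1.1 i
      obtain ⟨i, rfl⟩ := σ.surjective i
      rw [Z.act_one, show σ⁻¹ (σ i) = i from σ.symm_apply_apply i]
      induction i using Fin.addCases with
      | left i => exact J1 _ _ _
      | right i => exact J2 _ _ _
  · have h : ∀ i, Z.act (w.left i) (J p.1.1 p.2.1 (w.right⁻¹ i)) = J q.1.1 q.2.1 i := fun i =>
      congrFun (congrArg (fun v : V.X.carrier => v.1.1) h) i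
    -- Separation: for `i` in the first block, the entry of `q` at `i` lies in `Y` and is a
    -- translate of the entry of `p` at `w.right⁻¹ i`. That index is then in the first block as
    -- well, so `w.right⁻¹` preserves the blocks.
    obtain ⟨σ, hσ⟩ : ∃ σ, blockPerm k m σ = w.right⁻¹ := by
      refine exists_blockPerm _ fun i => ?_
      have h1 := h (Fin.castAdd m i)
      obtain ⟨a, ha⟩ : ∃ a, w.right⁻¹ (Fin.castAdd m i) = a := ⟨_, rfl⟩
      rw [ha, J1] at h1
      induction a using Fin.addCases with
      | left a => exact ⟨a, ha⟩
      | right a =>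
        rw [J2] at h1
        exact absurd (q.1.1 i).2 (h1 ▸ hi.compl _ _ (p.2.1 a).2)
    refine ⟨(⟨fun i => w.left (Fin.castAdd m i), σ.1⁻¹⟩,
      ⟨fun i => w.left (Fin.natAdd k i), σ.2⁻¹⟩), SemidirectProduct.ext (funext fun i => ?_) ?_⟩
    · change Fin.append _ _ i = w.left i
      induction i using Fin.addCases with
      | left i => exact Fin.append_left _ _ _
      | right i => exact Fin.append_right _ _ _
    · change blockPerm k m σ⁻¹ = w.right
      rw [map_inv, hσ, inv_inv]

/-- The series `λ` is multiplicative with respect to closed invariant subvarieties. -/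
theorem lambdaSeries_closed (Z : GVar G) {Y : Set Z.X.carrier} (hY : IsClosed[Z.X.top] Y)
    (hi : Z.Inv Y) : Z.lambdaSeries =
      (Z.sub Y (QPVar.isLC_of_isClosed hY) hi).lambdaSeries *
        (Z.sub Yᶜ (QPVar.isLC_compl hY) hi.compl).lambdaSeries := by
  ext n
  rw [coeff_lambdaSeries, PowerSeries.coeff_mul,
    ← Finset.sum_coe_sort (Finset.HasAntidiagonal.antidiagonal n)]
  -- Labelling strata by pairs `(k, n - k)` makes the sum over strata range over the index set of
  -- the Cauchy product; the subtraction is genuine by `entryCount_le`.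
  let l : (Z.conf n).X.carrier → Finset.HasAntidiagonal.antidiagonal n := fun x =>
    ⟨(entryCount Y x.1, n - entryCount Y x.1), Finset.HasAntidiagonal.mem_antidiagonal.2
      (Nat.add_sub_cancel' (entryCount_le Y x.1))⟩
  have hl : ∀ p : Finset.HasAntidiagonal.antidiagonal n, {x | l x = p} =
      {x : (Z.conf n).X.carrier | entryCount Y x.1 = p.1.1} := by
    rintro ⟨p, hp⟩
    rw [Finset.HasAntidiagonal.mem_antidiagonal] at hp
    ext x
    simp only [l, Set.mem_ofPred_eq, Subtype.mk.injEq, Prod.ext_iff]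
    omega
  rw [cls_pure_eq_sum (Z.conf n) l (fun p => hl p ▸ isLC_entryCount Z hY n p.1.1)
    (fun p => hl p ▸ inv_entryCount Z hi n p.1.1)]
  refine Finset.sum_congr rfl ?_
  rintro ⟨⟨k, m⟩, hp⟩ -
  obtain rfl := Finset.HasAntidiagonal.mem_antidiagonal.1 hp
  rw [coeff_lambdaSeries, coeff_lambdaSeries, cls_pure_mul, (isInduced_conf_prod Z hY hi k m).cls_eq]
  congr 2
  simp only [hl]

end conf

/-! ### From closed subsets to locally closed partitions -/

/-- A function on locally closed invariant sets which is multiplicative with respect to closed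
invariant subsets is multiplicative with respect to finite partitions into locally closed invariant
subsets. -/
theorem prod_of_closed_mul {T K M : Type*} [TopologicalSpace T] [Fintype K] [CommMonoid M]
    (p : Set T → Prop) (hpi : ∀ A B, p A → p B → p (A ∩ B)) (hpc : ∀ A, p A → p Aᶜ)
    (hpcl : ∀ A, p A → p (closure A)) (f : Set T → M) (hf0 : f ∅ = 1)
    (hf : ∀ A Y, IsLocallyClosed A → p A → IsClosed Y → p Y → f A = f (A ∩ Y) * f (A ∩ Yᶜ))
    (P : K → Set T) (hP : ∀ k, IsLocallyClosed (P k)) (hpP : ∀ k, p (P k))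
    (hd : Pairwise fun k l => Disjoint (P k) (P l)) (hc : ⋃ k, P k = Set.univ)
    (A : Set T) (hA : IsLocallyClosed A) (hpA : p A) : f A = ∏ k, f (A ∩ P k) := by
  classical
  -- The claim for the two halves of `A` cut by a closed `Y` gives it for `A`, because each `f (A ∩
  -- P k)` factors along the same `Y`.
  have split : ∀ A Y, IsLocallyClosed A → p A → IsClosed Y → p Y →
      f (A ∩ Y) = ∏ k, f (A ∩ Y ∩ P k) → f (A ∩ Yᶜ) = ∏ k, f (A ∩ Yᶜ ∩ P k) →
      f A = ∏ k, f (A ∩ P k) := by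
    intro A Y hA hpA hY hpY h1 h2
    rw [hf A Y hA hpA hY hpY, h1, h2, ← Finset.prod_mul_distrib]
    refine Finset.prod_congr rfl fun k _ => ?_
    rw [hf (A ∩ P k) Y (hA.inter (hP k)) (hpi _ _ hpA (hpP k)) hY hpY, Set.inter_right_comm A Y,
      Set.inter_right_comm A Yᶜ]
  -- The set `s` holds the undecided indices: for every `k` outside `s`, the part `P k` either
  -- contains `A` or misses it. With none left, `A` lies in one part, or meets none and is empty
  -- because the parts cover.
  have key : ∀ (s : Finset K) (A : Set T), IsLocallyClosed A → p A →
      (∀ k ∉ s, A ⊆ P k ∨ A ∩ P k = ∅) → f A = ∏ k, f (A ∩ P k) := by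
    intro s
    induction s using Finset.induction_on with
    | empty =>
      intro A _ _ h
      by_cases h1 : ∃ k, A ⊆ P k
      · obtain ⟨k, hk⟩ := h1
        rw [Finset.prod_eq_single k, Set.inter_eq_left.2 hk]
        · intro l _ hl
          rw [((hd hl).symm.mono_left hk).inter_eq, hf0]
        · exact fun h => absurd (Finset.mem_univ k) h
      · have h2 : ∀ k, A ∩ P k = ∅ := fun k =>
          (h k (Finset.notMem_empty k)).resolve_left fun h => h1 ⟨k, h⟩
        have h3 : A = ∅ := by
          rw [← Set.inter_univ A, ← hc, Set.inter_iUnion]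
          exact Set.iUnion_eq_empty.2 h2
        simp [h3, hf0]
    | insert l s _ ih =>
      intro A hA hpA h
      have hC : IsClosed (closure (P l)) := isClosed_closure
      -- Local closedness of `P l` makes its boundary `closure (P l) \ P l` closed. Cutting by the
      -- closure and then by this boundary leaves three pieces of `A`, one inside `P l` and two
      -- disjoint from it, so `l` becomes decided on each.
      have hD : IsClosed (closure (P l) \ P l) := by
        have := (hP l).isOpen_coborder
        rwa [coborder, isOpen_compl_iff] at this
      have hpC : p (closure (P l)) := hpcl _ (hpP l)
      have hpD : p (closure (P l) \ P l) := hpi _ _ hpC (hpc _ (hpP l))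
      have sub : ∀ B : Set T, B ⊆ A → (B ⊆ P l ∨ B ∩ P l = ∅) → ∀ k ∉ s, B ⊆ P k ∨ B ∩ P k = ∅ := by
        intro B hB hl k hk
        by_cases hkl : k = l
        · exact hkl ▸ hl
        · refine (h k fun hk' => (Finset.mem_insert.1 hk').elim hkl hk).imp hB.trans fun h => ?_
          exact Set.subset_eq_empty (Set.inter_subset_inter_left _ hB) h
      refine split A _ hA hpA hC hpC (split _ _ (hA.inter hC.isLocallyClosed) (hpi _ _ hpA hpC) hD
        hpD (ih _ ?_ ?_ ?_) (ih _ ?_ ?_ ?_)) (ih _ ?_ ?_ ?_)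
      · exact (hA.inter hC.isLocallyClosed).inter hD.isLocallyClosed
      · exact hpi _ _ (hpi _ _ hpA hpC) hpD
      · refine sub _ (fun x hx => hx.1.1) (Or.inr ?_)
        exact Set.eq_empty_of_forall_notMem fun x hx => hx.1.2.2 hx.2
      · exact (hA.inter hC.isLocallyClosed).inter hD.isOpen_compl.isLocallyClosed
      · exact hpi _ _ (hpi _ _ hpA hpC) (hpc _ hpD)
      · refine sub _ (fun x hx => hx.1.1) (Or.inl fun x hx => ?_)
        by_contra hx'
        exact hx.2 ⟨hx.1.2, hx'⟩
      · exact hA.inter hC.isOpen_compl.isLocallyClosed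
      · exact hpi _ _ hpA (hpc _ hpC)
      · refine sub _ (fun x hx => hx.1) (Or.inr ?_)
        exact Set.eq_empty_of_forall_notMem fun x hx => hx.1.2 (subset_closure hx.2)
  exact key Finset.univ A hA hpA fun k hk => absurd (Finset.mem_univ k) hk

variable {G H : Type} [Group G] [Group H]

/-- The group acts by continuous maps. Invariance of closures is what allows the cuts in
`prod_of_closed_mul` to stay within invariant sets. -/
theorem GVar.Inv.closure {Z : GVar G} {S : Set Z.X.carrier} (h : Z.Inv S) :
    Z.Inv (@_root_.closure _ Z.X.top S) := by
  let := Z.X.top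
  intro g
  exact Set.MapsTo.closure (fun x hx => h g x hx) (Z.mor g).continuous

/-- A retraction `ρ` of `V` onto `Z` restricts to the inverse of `j` on its image. It is requested
only in the presence of a point of `Z`, since no map from a nonempty `V` to an empty `Z` exists. -/
theorem isomorphic_sub_of_retract {Z V : GVar G} {S : Set V.X.carrier} (hS : V.X.IsLC S)
    (hi : V.Inv S) (j : Z.X.carrier → V.X.carrier) (hj : IsMor Z.X V.X j)
    (hjS : ∀ v, v ∈ S ↔ ∃ x, j x = v)
    (hr : ∀ _ : Z.X.carrier, ∃ ρ : V.X.carrier → Z.X.carrier, IsMor V.X Z.X ρ ∧ ∀ x, ρ (j x) = x)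
    (hact : ∀ g x, j (Z.act g x) = V.act g (j x)) : Isomorphic Z (V.sub S hS hi) := by
  choose ρ hρ hρj using hr
  let e : Z.X.carrier ≃ S := Equiv.ofBijective (fun x => ⟨j x, (hjS _).2 ⟨x, rfl⟩⟩) (by
    constructor
    · intro x y hxy
      rw [← hρj x x, ← hρj x y]
      exact congrArg (ρ x) (congrArg Subtype.val hxy)
    · rintro ⟨v, hv⟩
      obtain ⟨x, rfl⟩ := (hjS v).1 hv
      exact ⟨x, rfl⟩)
  refine ⟨MulEquiv.refl G, e, isMor_codRestrict hS hj, ?_, fun g x => Subtype.ext (hact g x)⟩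
  -- The retraction depends on a chosen point, but all of them agree on `S`, so any one may be used
  -- near `v`.
  refine IsMor.congr_local fun v => ⟨Set.univ, @isOpen_univ _ (QPVar.top _), trivial,
    fun w => ρ (e.symm v) w.1, (hρ _).comp (isMor_val _ _ hS), fun w _ => ?_⟩
  obtain ⟨x, rfl⟩ := e.surjective w
  exact (e.symm_apply_apply x).trans (hρj _ x).symm

/-! ### Invariance, normalisation and multiplicativity of the series -/

variable [Finite G] [Finite H]

theorem IsInduced.lambdaSeries_eq {Z : GVar G} {V : GVar H} (h : IsInduced Z V) :
    Z.lambdaSeries = V.lambdaSeries := by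
  ext n
  rw [coeff_lambdaSeries, coeff_lambdaSeries, (h.conf n).cls_eq]

theorem lambdaSeries_of_isomorphic {Z : GVar G} {V : GVar H} (h : Isomorphic Z V) :
    Z.lambdaSeries = V.lambdaSeries :=
  (IsInduced.of_isomorphic h).lambdaSeries_eq

theorem coeff_zero_lambdaSeries (Z : GVar G) : PowerSeries.coeff 0 Z.lambdaSeries = 1 := by
  rw [GVar.lambdaSeries, PowerSeries.coeff_mk, if_pos rfl]

/-- With a single entry the big diagonal is empty and the wreath product is `G` itself, so the
configuration space is `Z`. -/
theorem coeff_one_lambdaSeries (Z : GVar G) :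
    PowerSeries.coeff 1 Z.lambdaSeries = cls (FGVar.pure Z) := by
  rw [coeff_lambdaSeries]
  refine cls_eq (FGVar.equivalent_of_pieces' (Equiv.refl _) fun _ => Isomorphic.symm ?_)
  refine Isomorphic.of_maps (Z := Z) (W := Z.conf 1)
    { toFun := fun g => ⟨fun _ => g, 1⟩
      invFun := fun w => w.left 0
      left_inv := fun _ => rfl
      right_inv := fun w => SemidirectProduct.ext
        (funext fun i => congrArg w.left (Subsingleton.elim _ _)) (Subsingleton.elim _ _)
      map_mul' := fun _ _ => rfl }
    (fun x => ⟨fun _ => x, ?_⟩) (fun x => x.1 0) (isMor_conf fun _ => IsMor.id _)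
    (isMor_conf_apply Z 1 0) (fun _ => rfl)
    (fun y => Subtype.ext (funext fun i => congrArg y.1 (Subsingleton.elim _ _)))
    (fun _ _ => rfl)
  rintro ⟨i, j, hij, -⟩
  exact hij (Subsingleton.elim i j)

theorem lambdaSeries_of_isEmpty (Z : GVar G) [IsEmpty Z.X.carrier] : Z.lambdaSeries = 1 := by
  ext n
  rw [PowerSeries.coeff_one]
  split_ifs with h
  · rw [h, coeff_zero_lambdaSeries]
  · rw [coeff_lambdaSeries]
    exact FGVar.cls_of_isEmpty _ fun _ => ⟨fun x => IsEmpty.false (x.1 ⟨0, Nat.pos_of_ne_zero h⟩)⟩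

-- This is `prod_of_closed_mul` applied to the set function "series of `A`", with invariance as the
-- predicate and `lambdaSeries_closed` as the closed case.
open Classical in
theorem lambdaSeries_partition (Z : GVar G) {K : Type} [Fintype K] (l : Z.X.carrier → K)
    (hl : ∀ k, Z.X.IsLC {x | l x = k}) (hi : ∀ k, Z.Inv {x | l x = k}) :
    Z.lambdaSeries = ∏ k, (Z.sub _ (hl k) (hi k)).lambdaSeries := by
  let := Z.X.top
  -- The default value `1` plays no role: the argument evaluates `f` only at invariant locally
  -- closed sets.
  let f : Set Z.X.carrier → PowerSeries K0 := fun A =>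
    if h : Z.X.IsLC A ∧ Z.Inv A then (Z.sub A h.1 h.2).lambdaSeries else 1
  have hf : ∀ A (h1 : Z.X.IsLC A) (h2 : Z.Inv A), f A = (Z.sub A h1 h2).lambdaSeries :=
    fun A h1 h2 => dif_pos ⟨h1, h2⟩
  have h := prod_of_closed_mul Z.Inv (fun A B hA hB g x hx => ⟨hA g x hx.1, hB g x hx.2⟩)
    (fun A hA => hA.compl) (fun A hA => hA.closure) f ?_ ?_ (fun k => {x | l x = k}) hl hi ?_ ?_
    Set.univ Z.X.isLC_univ fun _ _ _ => trivial
  · rw [hf _ Z.X.isLC_univ fun _ _ _ => trivial] at h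
    rw [← lambdaSeries_of_isomorphic (Isomorphic.sub_univ Z Set.univ Z.X.isLC_univ
      (fun _ _ _ => trivial) fun _ => trivial), h]
    refine Finset.prod_congr rfl fun k _ => ?_
    rw [Set.univ_inter, hf _ (hl k) (hi k)]
  · have h1 : Z.X.IsLC ∅ := QPVar.isLC_of_isClosed isClosed_empty
    have h2 : Z.Inv ∅ := fun _ _ hx => hx
    rw [hf ∅ h1 h2]
    have : IsEmpty (Z.sub ∅ h1 h2).X.carrier := ⟨fun x => x.2⟩
    exact lambdaSeries_of_isEmpty _
  · intro A Y hA hAi hY hYi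
    have hA1 : Z.X.IsLC (A ∩ Y) := QPVar.IsLC.inter hA (QPVar.isLC_of_isClosed hY)
    have hA2 : Z.X.IsLC (A ∩ Yᶜ) := QPVar.IsLC.inter hA (QPVar.isLC_compl hY)
    have hi1 : Z.Inv (A ∩ Y) := fun g x hx => ⟨hAi g x hx.1, hYi g x hx.2⟩
    have hi2 : Z.Inv (A ∩ Yᶜ) := fun g x hx => ⟨hAi g x hx.1, hYi.compl g x hx.2⟩
    have hY' : IsClosed[(Z.sub A hA hAi).X.top] (Subtype.val ⁻¹' Y) := by
      let := (Z.sub A hA hAi).X.top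
      exact hY.preimage (isMor_val _ A hA).continuous
    have hYi' : (Z.sub A hA hAi).Inv (Subtype.val ⁻¹' Y) := fun g x hx => hYi g x.1 hx
    rw [hf A hA hAi, hf _ hA1 hi1, hf _ hA2 hi2, lambdaSeries_closed _ hY' hYi']
    congr 1
    · exact lambdaSeries_of_isomorphic (Isomorphic.sub_sub Z A hA hAi _ _ hYi' _ hA1 hi1 fun x =>
        ⟨fun hx => ⟨hx.1, hx.2⟩, fun ⟨h1, h2⟩ => ⟨h1, h2⟩⟩)
    · exact lambdaSeries_of_isomorphic (Isomorphic.sub_sub Z A hA hAi _ _ hYi'.compl _ hA2 hi2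
        fun x => ⟨fun hx => ⟨hx.1, hx.2⟩, fun ⟨h1, h2⟩ => ⟨h1, h2⟩⟩)
  · intro k k' hk
    exact Set.disjoint_left.2 fun x (h1 : l x = k) (h2 : l x = k') => hk (h1.symm.trans h2)
  · exact Set.eq_univ_of_forall fun x => Set.mem_iUnion.2 ⟨l x, rfl⟩

theorem lambdaSeries_isCompl (Z : GVar G) {S T : Set Z.X.carrier} (hS : Z.X.IsLC S)
    (hT : Z.X.IsLC T) (hSi : Z.Inv S) (hTi : Z.Inv T) (h : IsCompl S T) :
    Z.lambdaSeries = (Z.sub S hS hSi).lambdaSeries * (Z.sub T hT hTi).lambdaSeries := by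
  classical
  let l : Z.X.carrier → Bool := fun x => decide (x ∈ S)
  have h1 : {x | l x = true} = S := by
    ext x
    simp [l]
  have h2 : {x | l x = false} = T := by
    rw [← h.compl_eq]
    ext x
    simp [l]
  have hl : ∀ b, Z.X.IsLC {x | l x = b} := by
    rintro (_ | _)
    · rwa [h2]
    · rwa [h1]
  have hi : ∀ b, Z.Inv {x | l x = b} := by
    rintro (_ | _)
    · rwa [h2]
    · rwa [h1]
  rw [lambdaSeries_partition Z l hl hi, Fintype.prod_bool]
  congr 2
  · congr 1
  · congr 1

/-- The summands are the two open parts of a partition of the disjoint union. Each is a retract of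
it, by the identity on that summand and a constant map on the other. -/
theorem lambdaSeries_sum (Z W : GVar G) :
    (Z.sum W).lambdaSeries = Z.lambdaSeries * W.lambdaSeries := by
  let l : Z.X.carrier ⊕ W.X.carrier → Bool := Sum.isRight
  have hopen : ∀ b : Bool, IsOpen[(Z.X.sum W.X).top] {x | l x = b} := fun b => by
    have h := @Continuous.isOpen_preimage _ _ (_) (_) _ (isMor_transport
      (QPVar.sigma (fun b : Bool => match b with | false => Z.X | true => W.X))
      (T := Z.X.carrier ⊕ W.X.carrier)
      { toFun := Sum.elim (fun x => ⟨false, x⟩) (fun y => ⟨true, y⟩)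
        invFun := fun z => match z with | ⟨false, x⟩ => Sum.inl x | ⟨true, y⟩ => Sum.inr y
        left_inv := by rintro (x | y) <;> rfl
        right_inv := by rintro ⟨_ | _, x⟩ <;> rfl }).continuous _
      (Isomorphic.isOpen_component
        (fun b : Bool => match b with | false => Z.X | true => W.X) b)
    refine (show {x | l x = b} = _ from Set.ext ?_) ▸ h
    rintro (x | x) <;> exact Iff.rfl
  have hl : ∀ b, (Z.sum W).X.IsLC {x | l x = b} := fun b => QPVar.isLC_of_isOpen (hopen b)
  have hi : ∀ b, (Z.sum W).Inv {x | l x = b} := by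
    rintro b g (x | x) hx <;> exact hx
  -- `Fintype.prod_bool` puts the factor at `true` first, which belongs to `W`; hence the swap.
  rw [lambdaSeries_partition (Z.sum W) l hl hi, Fintype.prod_bool, mul_comm]
  congr 1
  · refine (lambdaSeries_of_isomorphic (isomorphic_sub_of_retract (Z := Z) (hl false) (hi false)
      Sum.inl (isMor_inl _ _) ?_ (fun x => ⟨Sum.elim id fun _ => x,
        isMor_sum (IsMor.id _) (Isomorphic.isMor_const _ _ x), fun _ => rfl⟩)
      fun _ _ => rfl)).symm
    rintro (x | x) <;> simp [l]
  · refine (lambdaSeries_of_isomorphic (isomorphic_sub_of_retract (Z := W) (hl true) (hi true)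
      Sum.inr (isMor_inr _ _) ?_ (fun x => ⟨Sum.elim (fun _ => x) id,
        isMor_sum (Isomorphic.isMor_const _ _ x) (IsMor.id _), fun _ => rfl⟩)
      fun _ _ => rfl)).symm
    rintro (x | x) <;> simp [l]

/-! ### Descent to the Grothendieck ring -/

/-- Negatives in the Grothendieck ring need inverse series. With values in the unit group the target
is an abelian group, and the universal property of the quotient applies. -/
theorem isUnit_lambdaSeries (Z : GVar G) : IsUnit Z.lambdaSeries := by
  rw [PowerSeries.isUnit_iff_constantCoeff, ← PowerSeries.coeff_zero_eq_constantCoeff_apply,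
    coeff_zero_lambdaSeries]
  exact isUnit_one

/-- The series `λ` as an invertible power series. -/
noncomputable def lambdaUnit (Z : GVar G) : (PowerSeries K0)ˣ := (isUnit_lambdaSeries Z).unit

/-- The product of the series `λ` of the components of a variety with a finite groups action. -/
noncomputable def lambdaFG (𝒳 : FGVar) : (PowerSeries K0)ˣ :=
  ∏ᶠ i, lambdaUnit (𝒳.piece i)

theorem coe_lambdaFG (𝒳 : FGVar) [Fintype 𝒳.I] :
    (lambdaFG 𝒳 : PowerSeries K0) = ∏ i, (𝒳.piece i).lambdaSeries := by
  rw [lambdaFG, finprod_eq_prod_of_fintype, Units.coe_prod]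
  rfl

theorem coe_lambdaFG_pure (Z : GVar G) :
    (lambdaFG (FGVar.pure Z) : PowerSeries K0) = Z.lambdaSeries := by
  have : Fintype (FGVar.pure Z).I := inferInstanceAs (Fintype Unit)
  rw [coe_lambdaFG]
  exact Fintype.prod_unique (ι := Unit) _

/-- Passing to the parts of any partition leaves the product unchanged. Two equivalent varieties
then have products over pairwise isomorphic parts, which is compatibility with relation (1). -/
theorem coe_lambdaFG_partition {𝒳 : FGVar} (P : 𝒳.Partition) :
    (lambdaFG 𝒳 : PowerSeries K0) = ∏ᶠ k, (P.part k).lambdaSeries := by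
  have := Fintype.ofFinite 𝒳.I
  have := P.fin
  have := fun i => Fintype.ofFinite (P.K i)
  rw [finprod_eq_prod_of_fintype, coe_lambdaFG, Finset.prod_congr rfl fun i _ =>
    lambdaSeries_partition (𝒳.piece i) (P.label i) (P.lc i) (P.inv i)]
  exact (Fintype.prod_sigma' _).symm

theorem lambdaFG_eq_of_equivalent {𝒳 𝒴 : FGVar} (h : 𝒳.Equivalent 𝒴) :
    lambdaFG 𝒳 = lambdaFG 𝒴 := by
  obtain ⟨P, Q, e, h⟩ := h
  refine Units.ext ?_
  rw [coe_lambdaFG_partition P, coe_lambdaFG_partition Q]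
  exact finprod_eq_of_bijective e e.bijective fun k => lambdaSeries_of_isomorphic (h k)

/-- The claim splits over the components: `Y` pulls back to a closed invariant subset of each, so
relation (2) uses only the closed case of multiplicativity. -/
theorem lambdaFG_closed (𝒳 : FGVar) {Y : Set 𝒳.ambient.carrier} (hY : IsClosed[𝒳.ambient.top] Y)
    (hi : 𝒳.Inv Y) : lambdaFG 𝒳 = lambdaFG (𝒳.restrict Y (QPVar.isLC_of_isClosed hY) hi) *
      lambdaFG (𝒳.restrict Yᶜ (QPVar.isLC_compl hY) hi.compl) := by
  have : Fintype 𝒳.I := Fintype.ofFinite 𝒳.I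
  refine Units.ext ?_
  rw [Units.val_mul, coe_lambdaFG 𝒳, coe_lambdaFG (𝒳.restrict Y _ hi),
    coe_lambdaFG (𝒳.restrict Yᶜ _ hi.compl), ← Finset.prod_mul_distrib]
  refine Finset.prod_congr rfl fun i _ => ?_
  refine lambdaSeries_closed (𝒳.piece i) ?_ (hi i)
  let := 𝒳.ambient.top
  let := (𝒳.piece i).X.top
  exact hY.preimage (𝒳.imm i).isMor.continuous

/-- The `λ`-structure, as a homomorphism. -/
noncomputable def lambdaHom : K0 →+ Additive (PowerSeries K0)ˣ :=
  QuotientAddGroup.lift _ (FreeAbelianGroup.lift fun 𝒳 => Additive.ofMul (lambdaFG 𝒳))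
    ((AddSubgroup.closure_le _).2 fun r hr => by
      change FreeAbelianGroup.lift (fun 𝒳 => Additive.ofMul (lambdaFG 𝒳)) r = 0
      cases hr with
      | equivalent 𝒳 𝒴 h =>
        rw [map_sub, FreeAbelianGroup.lift_apply_of, FreeAbelianGroup.lift_apply_of, sub_eq_zero,
          lambdaFG_eq_of_equivalent h]
      | closed 𝒳 Y hY hi =>
        rw [map_sub, map_add, FreeAbelianGroup.lift_apply_of, FreeAbelianGroup.lift_apply_of,
          FreeAbelianGroup.lift_apply_of, sub_eq_zero, lambdaFG_closed 𝒳 hY hi, ofMul_mul]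
      | ind φ hφ Z =>
        rw [map_sub, FreeAbelianGroup.lift_apply_of, FreeAbelianGroup.lift_apply_of, sub_eq_zero]
        refine congrArg Additive.ofMul (Units.ext ?_)
        rw [coe_lambdaFG_pure, coe_lambdaFG_pure]
        exact (IsInduced.of_ind Z φ hφ).lambdaSeries_eq.symm)

theorem lambdaHom_cls (𝒳 : FGVar) : lambdaHom (cls 𝒳) = Additive.ofMul (lambdaFG 𝒳) :=
  FreeAbelianGroup.lift_apply_of _ _

/-- The power series `λ_a(t)`. -/
noncomputable def lambda (a : K0) : PowerSeries K0 := ((lambdaHom a).toMul : (PowerSeries K0)ˣ)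

theorem lambda_add (a b : K0) : lambda (a + b) = lambda a * lambda b := by
  rw [lambda, map_add, toMul_add, Units.val_mul]
  rfl

theorem lambda_zero : lambda 0 = 1 := by
  rw [lambda, map_zero, toMul_zero, Units.val_one]

theorem lambda_cls_pure (Z : GVar G) : lambda (cls (FGVar.pure Z)) = Z.lambdaSeries := by
  rw [lambda, lambdaHom_cls, toMul_ofMul, coe_lambdaFG_pure]

/-! ### Normalisation of the low coefficients and uniqueness -/

/-- Induction on elements of the Grothendieck ring, starting from the classes of varieties with
pure actions. -/
theorem K0.induction_pure {p : K0 → Prop} (h0 : p 0)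
    (hc : ∀ (G : Type) [Group G] [Finite G] (Z : GVar G), p (cls (FGVar.pure Z)))
    (hn : ∀ a, p a → p (-a)) (ha : ∀ a b, p a → p b → p (a + b)) (a : K0) : p a := by
  refine K0.induction h0 (fun 𝒳 => ?_) hn ha a
  have := Fintype.ofFinite 𝒳.I
  rw [FGVar.cls_eq_sum]
  exact Finset.sum_induction _ p ha h0 fun i _ => hc _ _

theorem coeff_zero_mul {R : Type*} [CommRing R] (a b : PowerSeries R) :
    PowerSeries.coeff 0 (a * b) = PowerSeries.coeff 0 a * PowerSeries.coeff 0 b := by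
  simp

/-- The unit group as target does not record the constant term, so it is propagated from pure
classes through sums and negatives. -/
theorem coeff_zero_lambda (a : K0) : PowerSeries.coeff 0 (lambda a) = 1 := by
  induction a using K0.induction_pure with
  | h0 => rw [lambda_zero, PowerSeries.coeff_zero_one]
  | hc G Z => rw [lambda_cls_pure, coeff_zero_lambdaSeries]
  | hn a h =>
    have h1 := congrArg (PowerSeries.coeff 0) (lambda_add (-a) a)
    rw [neg_add_cancel, lambda_zero, coeff_zero_mul, h, mul_one,
      PowerSeries.coeff_zero_one] at h1
    exact h1.symm
  | ha a b h h' => rw [lambda_add, coeff_zero_mul, h, h', mul_one]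

/-- For series with constant term `1`, the coefficient of `t` turns products into sums. It is
therefore additive in `a`, and comparison with the identity on pure classes determines it. -/
theorem coeff_one_lambda_add (a b : K0) : PowerSeries.coeff 1 (lambda (a + b)) =
    PowerSeries.coeff 1 (lambda a) + PowerSeries.coeff 1 (lambda b) := by
  rw [lambda_add, PowerSeries.coeff_mul, Finset.Nat.antidiagonal_succ]
  simp [coeff_zero_lambda, -PowerSeries.coeff_zero_eq_constantCoeff, add_comm]

theorem coeff_one_lambda (a : K0) : PowerSeries.coeff 1 (lambda a) = a := by
  have hz : PowerSeries.coeff 1 (lambda 0) = 0 := by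
    simpa using coeff_one_lambda_add 0 0
  induction a using K0.induction_pure with
  | h0 => exact hz
  | hc G Z => rw [lambda_cls_pure, coeff_one_lambdaSeries]
  | hn a h =>
    have h1 := coeff_one_lambda_add (-a) a
    rw [neg_add_cancel, hz, h] at h1
    exact eq_neg_of_add_eq_zero_left h1.symm
  | ha a b h h' => rw [coeff_one_lambda_add, h, h']

theorem isLambdaStructure_lambda : IsLambdaStructure lambda :=
  ⟨coeff_zero_lambda, coeff_one_lambda, lambda_add⟩

/-- `L 0` equals its own square and is a unit because its constant term is `1`. -/
theorem IsLambdaStructure.map_zero {R : Type 1} [CommRing R] {L : R → PowerSeries R}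
    (hL : IsLambdaStructure L) : L 0 = 1 := by
  have hu : IsUnit (L 0) := by
    rw [PowerSeries.isUnit_iff_constantCoeff, ← PowerSeries.coeff_zero_eq_constantCoeff_apply,
      hL.coeff_zero]
    exact isUnit_one
  refine hu.mul_left_cancel ?_
  rw [← hL.add, add_zero, mul_one]

/-- Both maps turn sums into products and agree on pure classes, which generate. At `-a` both values
are inverse to the same series. -/
theorem IsLambdaStructure.eq_lambda {L : K0 → PowerSeries K0} (hL : IsLambdaStructure L)
    (h : ∀ (G : Type) [Group G] [Finite G] (Z : GVar G),
      L (cls (FGVar.pure Z)) = Z.lambdaSeries) : L = lambda := by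
  funext a
  induction a using K0.induction_pure with
  | h0 => rw [hL.map_zero, lambda_zero]
  | hc G Z => rw [h, lambda_cls_pure]
  | hn a ha =>
    have h1 : L (-a) * L a = 1 := by rw [← hL.add, neg_add_cancel, hL.map_zero]
    have h2 : lambda (-a) * lambda a = 1 := by rw [← lambda_add, neg_add_cancel, lambda_zero]
    rw [ha] at h1
    exact (left_inv_eq_right_inv h1 ((mul_comm _ _).trans h2))
  | ha a b h h' => rw [hL.add, lambda_add, h, h']

end FGr

/-- The series `λ_{(Z,G)}(t)` is multiplicative for disjoint unions of `G`-varieties (external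
ones, and decompositions of a `G`-variety into two invariant locally closed subvarieties); it is
invariant under the induction along an embedding `φ` of finite groups; and there is one and only one
`λ`-structure on the Grothendieck ring taking the value `λ_{(Z,G)}(t)` on every class
`[(Z,G)]`. -/
theorem mainTheorem7 :
    (∀ (G : Type) [Group G] [Finite G] (Z₁ Z₂ : FGr.GVar G),
      (Z₁.sum Z₂).lambdaSeries = Z₁.lambdaSeries * Z₂.lambdaSeries) ∧
    (∀ (G : Type) [Group G] [Finite G] (Z : FGr.GVar G) (S T : Set Z.X.carrier)
      (hS : Z.X.IsLC S) (hT : Z.X.IsLC T) (hSi : Z.Inv S) (hTi : Z.Inv T), IsCompl S T →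
      Z.lambdaSeries = (Z.sub S hS hSi).lambdaSeries * (Z.sub T hT hTi).lambdaSeries) ∧
    (∀ (G H : Type) [Group G] [Finite G] [Group H] [Finite H] (φ : G →* H)
      (hφ : Function.Injective φ) (Z : FGr.GVar G),
      Z.lambdaSeries = (Z.ind φ hφ).lambdaSeries) ∧
    (∃! L : FGr.K0 → PowerSeries FGr.K0, FGr.IsLambdaStructure L ∧
      ∀ (G : Type) [Group G] [Finite G] (Z : FGr.GVar G),
        L (FGr.cls (FGr.FGVar.pure Z)) = Z.lambdaSeries) := by
  refine ⟨fun G _ _ Z₁ Z₂ => FGr.lambdaSeries_sum Z₁ Z₂,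
    fun G _ _ Z S T hS hT hSi hTi h => FGr.lambdaSeries_isCompl Z hS hT hSi hTi h,
    fun G H _ _ _ _ φ hφ Z => (FGr.IsInduced.of_ind Z φ hφ).lambdaSeries_eq,
    FGr.lambda, ⟨FGr.isLambdaStructure_lambda, fun G _ _ Z => FGr.lambda_cls_pure Z⟩,
    fun L hL => hL.1.eq_lambda hL.2⟩
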